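/- Let $M$ be a smooth manifold of dimension $n\ge 2$ and let $F:TM\to\mathbb R$ be a Finsler function: $F$ is smooth and positive on the set $\mathcal TM$ of non-zero tangent vectors, positively $1$-homogeneous in $y$, and, with $E=\tfrac12F^2$, the metric tensor $g_{ij}=\dot\partial_i\dot\partial_jE$ has rank $n$ on $\mathcal TM$ (here $\partial_i=\partial/\partial x^i$, $\dot\partial_i=\partial/\partial y^i$ in induced coordinates $(x^i,y^i)$ of $TM$). Let $S=y^i\partial_i-2G^i\dot\partial_i$ be its geodesic spray, i.e. the spray ($G^i$ smooth on $\mathcal TM$ and positively $2$-homogeneous in $y$) with $S(\dot\partial_iE)=\partial_iE$ on $\mathcal TM$, and put $G^h_{ij}=\dot\partial_i\dot\partial_jG^h$, $G^h_{ijk}=\dot\partial_kG^h_{ij}$. Suppose that $(M,F)$ is a Landsberg space, i.e. $L_{ijk}=-\tfrac12F\,G^h_{ijk}\,\dot\partial_hF=0$ on $\mathcal TM$, and that it admits a smooth $1$-form $\beta=b_i(x)y^i$, not identically zero on any connected component of $M$, which is parallel: $b_{i|j}=\partial_jb_i-G^h_{ij}b_h=0$ on $\mathcal TM$. Functions $F_1,\dots,F_k$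 on $\mathcal TM$ are called functionally independent if there is no non-empty open subset of $\mathcal TM$ on which $dF_1,\dots,dF_k$ are linearly dependent at every point. The metrizability freedom of a spray $S$ is the largest number (possibly $\infty$) of functionally independent Finsler functions on $M$ whose geodesic spray is $S$. Then the metrizability freedom of $S$ is at least $2$. Moreover, whenever $F+\beta$ is positive on $\mathcal TM$, the Randers change $F+\beta$ is a Finsler function whose geodesic spray is $S$, it is again Landsberg, and $F$ and $F+\beta$ are functionally independent. -/

import Mathlib

open scoped Manifold ContDiff

noncomputable section

namespace Finsler

variable {n : ℕ} {M : Type*} [TopologicalSpace M] [ChartedSpace (EuclideanSpace ℝ (Fin n)) M]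
  [IsManifold (𝓡 n) ∞ M]

/-- The model space `ℝⁿ`. -/
abbrev Vec (n : ℕ) : Type := EuclideanSpace ℝ (Fin n)

/-! ### Directional derivatives on `ℝⁿ × ℝⁿ`, with coordinates `(x, y)`

For `u = e_i` these are the operators `∂_i = ∂/∂x^i` and `∂̇_i = ∂/∂y^i`. -/

/-- `u^i ∂f/∂x^i`. -/
def dX {W : Type*} [NormedAddCommGroup W] [NormedSpace ℝ W] (u : Vec n) (f : Vec n × Vec n → W) :
    Vec n × Vec n → W :=
  fun z => fderiv ℝ f z (u, 0)

/-- `u^i ∂f/∂y^i`. -/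
def dY {W : Type*} [NormedAddCommGroup W] [NormedSpace ℝ W] (u : Vec n) (f : Vec n × Vec n → W) :
    Vec n × Vec n → W :=
  fun z => fderiv ℝ f z (0, u)

/-! ### The tangent bundle in induced coordinates -/

variable (n M) in
/-- The set of non-zero tangent vectors, the slit tangent bundle. -/
def slit : Set (TangentBundle (𝓡 n) M) := {v | v.2 ≠ 0}

/-- The chart `v ↦ (x, y)` of `TM` induced by the preferred chart of `M` at `p`. -/
def tangentChart (p : M) : PartialEquiv (TangentBundle (𝓡 n) M) (Vec n × Vec n) :=
  extChartAt (𝓡 n).tangent (⟨p, 0⟩ : TangentBundle (𝓡 n) M)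

variable (n) in
/-- The coordinates `(x, y)`, `y ≠ 0`, of the non-zero tangent vectors over the domain of the
preferred chart at `p`: an open subset of `ℝⁿ × ℝⁿ`. -/
def slitDomain (p : M) : Set (Vec n × Vec n) := (extChartAt (𝓡 n) p).target ×ˢ {0}ᶜ

/-- The local expression `f(x, y)` of a function on `TM` in the induced coordinates. -/
def localExpr (f : TangentBundle (𝓡 n) M → ℝ) (p : M) : Vec n × Vec n → ℝ :=
  fun z => f ((tangentChart p).symm z)

/-- The components `(S^i_x, S^i_y)`, in the induced coordinates, of a vector field on `TM`. -/
def localField (S : ∀ v : TangentBundle (𝓡 n) M, TangentSpace (𝓡 n).tangent v) (p : M) :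
    Vec n × Vec n → Vec n × Vec n :=
  fun z => mfderiv (𝓡 n).tangent 𝓘(ℝ, Vec n × Vec n) (tangentChart (n := n) p)
    ((tangentChart p).symm z) (S ((tangentChart p).symm z))

/-! ### Finsler functions -/

/-- The energy `E = F² / 2`. -/
def energy (F : TangentBundle (𝓡 n) M → ℝ) : TangentBundle (𝓡 n) M → ℝ :=
  fun v => F v ^ 2 / 2

/-- `F` is a Finsler function on `M`: it is smooth and positive on the slit tangent bundle,
positively `1`-homogeneous, and its metric tensor `g_{ij} = ∂̇_i ∂̇_j E` has rank `n` (the linear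
map `u ↦ u^i g_{ij}` has trivial kernel) at every non-zero tangent vector. -/
structure IsFinsler (F : TangentBundle (𝓡 n) M → ℝ) : Prop where
  smooth : ContMDiffOn (𝓡 n).tangent 𝓘(ℝ, ℝ) ∞ F (slit n M)
  pos : ∀ v ∈ slit n M, 0 < F v
  homogeneous : ∀ (x : M) (y : TangentSpace (𝓡 n) x) (c : ℝ), 0 < c →
    F (⟨x, c • y⟩ : TangentBundle (𝓡 n) M) = c * F (⟨x, y⟩ : TangentBundle (𝓡 n) M)
  nondegenerate : ∀ p : M, ∀ z ∈ slitDomain n p, ∀ u : Vec n,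
    (∀ w : Vec n, dY u (dY w (localExpr (energy F) p)) z = 0) → u = 0

/-! ### Sprays -/

variable (n M) in
/-- A spray on `M`: a vector field on `TM` which in induced coordinates is
`S = y^i ∂/∂x^i - 2 G^i ∂/∂y^i`, where the `G^i` are smooth for `y ≠ 0` and positively
`2`-homogeneous in `y`. -/
structure Spray where
  field : ∀ v : TangentBundle (𝓡 n) M, TangentSpace (𝓡 n).tangent v
  semispray : ∀ p : M, ∀ x ∈ (extChartAt (𝓡 n) p).target, ∀ y : Vec n,
    (localField field p (x, y)).1 = y
  smooth : ∀ p : M, ContDiffOn ℝ ∞ (localField field p) (slitDomain n p)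
  homogeneous : ∀ p : M, ∀ x ∈ (extChartAt (𝓡 n) p).target, ∀ (y : Vec n) (c : ℝ), 0 < c →
    (localField field p (x, c • y)).2 = c ^ 2 • (localField field p (x, y)).2

namespace Spray

variable (S : Spray n M)

/-- The spray coefficients `G = (G^1, …, G^n)` in the induced coordinates. -/
def coeff (p : M) : Vec n × Vec n → Vec n :=
  fun z => -(1 / 2 : ℝ) • (localField S.field p z).2

/-- The coefficients `u^i v^j G^h_{ij} = u^i v^j ∂̇_i ∂̇_j G^h` of the Berwald connection. -/
def berwaldCoeff (p : M) (u v : Vec n) : Vec n × Vec n → Vec n :=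
  dY u (dY v (S.coeff p))

/-- The Berwald curvature `u^i v^j w^k G^h_{ijk} = u^i v^j w^k ∂̇_k G^h_{ij}`. -/
def berwaldCurvature (p : M) (u v w : Vec n) : Vec n × Vec n → Vec n :=
  dY w (S.berwaldCoeff p u v)

/-- The Landsberg curvature `u^i v^j w^k L_{ijk}`, `L_{ijk} = -(1/2) F G^h_{ijk} ∂̇_h F`,
of a Finsler function `F` with geodesic spray `S`. -/
def landsbergCurvature (F : TangentBundle (𝓡 n) M → ℝ) (p : M) (u v w : Vec n)
    (z : Vec n × Vec n) : ℝ :=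
  -(1 / 2 : ℝ) * localExpr F p z * dY (S.berwaldCurvature p u v w z) (localExpr F p) z

/-- `S` is the geodesic spray of `F`: the Euler–Lagrange equations `S(∂E/∂y^i) = ∂E/∂x^i` of the
energy hold on the slit tangent bundle, equivalently
`2 g_{ij} G^j = y^r ∂_r ∂̇_i E - ∂_i E`. -/
def IsGeodesicSpray (F : TangentBundle (𝓡 n) M → ℝ) : Prop :=
  ∀ p : M, ∀ z ∈ slitDomain n p, ∀ w : Vec n,
    fderiv ℝ (dY w (localExpr (energy F) p)) z (z.2, -(2 : ℝ) • S.coeff p z) =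
      dX w (localExpr (energy F) p) z

/-- The Landsberg curvature of `F`, whose geodesic spray is `S`, vanishes identically. -/
def IsLandsberg (F : TangentBundle (𝓡 n) M → ℝ) : Prop :=
  ∀ p : M, ∀ z ∈ slitDomain n p, ∀ u v w : Vec n, S.landsbergCurvature F p u v w z = 0

end Spray

/-! ### One-forms -/

/-- The function `β = b_i(x) y^i` on `TM` given by a field of covectors. -/
def formFun (β : ∀ x : M, TangentSpace (𝓡 n) x →L[ℝ] ℝ) : TangentBundle (𝓡 n) M → ℝ :=
  fun v => β v.1 v.2

/-- The field of covectors `β` is a smooth `1`-form: `b_i(x) y^i` is smooth on `TM`. -/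
def IsSmoothForm (β : ∀ x : M, TangentSpace (𝓡 n) x →L[ℝ] ℝ) : Prop :=
  ContMDiff (𝓡 n).tangent 𝓘(ℝ, ℝ) ∞ (formFun β)

/-- `β` is (horizontally) parallel with respect to the Berwald connection of `S`:
`b_{i|j} = ∂_j b_i - G^h_{ij} b_h = 0`, where `u^i b_i(x)` is the local expression of `b_i y^i`
at `(x, u)`. -/
def Spray.IsParallel (S : Spray n M) (β : ∀ x : M, TangentSpace (𝓡 n) x →L[ℝ] ℝ) : Prop :=
  ∀ p : M, ∀ z ∈ slitDomain n p, ∀ u v : Vec n,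
    dX v (localExpr (formFun β) p) (z.1, u) -
      localExpr (formFun β) p (z.1, S.berwaldCoeff p u v z) = 0

/-! ### Functional independence and metrizability freedom -/

/-- The differential `df` of a function on `TM` at `v`. -/
def differential (f : TangentBundle (𝓡 n) M → ℝ) (v : TangentBundle (𝓡 n) M) :
    TangentSpace (𝓡 n).tangent v →L[ℝ] ℝ :=
  mfderiv (𝓡 n).tangent 𝓘(ℝ, ℝ) f v

/-- The functions `f i` on the slit tangent bundle are (locally) functionally independent: there is
no non-empty open set on which the differentials `d(f i)` are linearly dependent at every point. -/
def FunctionallyIndependent {k : ℕ} (f : Fin k → TangentBundle (𝓡 n) M → ℝ) : Prop :=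
  ∀ U : Set (TangentBundle (𝓡 n) M), IsOpen U → U ⊆ slit n M → U.Nonempty →
    ∃ v ∈ U, LinearIndependent ℝ (fun i => differential (f i) v)

/-- The metrizability freedom of a spray `S`: the largest number of functionally independent
Finsler functions on `M` whose geodesic spray is `S` (`⊤` if there is no largest number). -/
def Spray.metrizabilityFreedom (S : Spray n M) : ℕ∞ :=
  sSup {m : ℕ∞ | ∃ (k : ℕ) (f : Fin k → TangentBundle (𝓡 n) M → ℝ), m = k ∧
    (∀ i, IsFinsler (f i) ∧ S.IsGeodesicSpray (f i)) ∧ FunctionallyIndependent f}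

end Finsler

end

/-!
Everything is read off the function `F` itself rather than its energy. Because `F` is positive and
`1`-homogeneous, contracting the Euler–Lagrange equations of `F² / 2` with `y` gives `S F = 0`, and
then `S(∂̇_i F) = ∂_i F` (`eulerLagrange_of_half_sq`); conversely these two relations for a function
give the Euler–Lagrange equations of half its square. A parallel form satisfies both:
`S β = y^i y^j G^h_{ij} b_h - 2 G^h b_h = 0` by Euler's relation, and `∂_j b_i = G^h_{ij} b_h` is
symmetric, so that `S(b_i) = ∂_i β` (`eulerLagrange_of_parallel`). Both relations are linear, hence
`F + β` has geodesic spray `S`; the energy of `√(F² + β²)` is the sum of those of `F` and `β`, so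
this function has geodesic spray `S` as well.

`F + β` has the same vertical Hessian as `F`, and the rank of the metric depends only on the kernel
of that Hessian (`nondegenerate_of_dY_dY_eq`). Its Landsberg curvature vanishes since
`b_h G^h_{ijk} = ∂̇_k ∂_j b_i = 0` (`dY_berwald_of_parallel`).

Since `F + β`, and even `F + ε β` with a constant `ε`, may fail to be positive, the lower bound for
the metrizability freedom uses `√(F² + β²)`, which is always positive. Its metric is `g + b ⊗ b`,
nondegenerate because `g` is positive definite (`IsFinsler.metric_pos`): a positive `2`-homogeneous
function has a positive definite Hessian where its restriction to the unit sphere is minimal, and in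
dimension at least two a nondegenerate form cannot change signature over the connected set of nonzero
vectors.

For functional independence, unique continuation along segments shows that `β` vanishes nowhere
(`form_ne_zero_of_parallel`). If `u ≠ 0` is in the kernel of `b_i(x)`, then `u^i ∂̇_i F` cannot vanish
on an open part of the fibre over `x`, since otherwise `u^i g_{ij} = 0` there; evaluating a relation
between the differentials on `u` and on `y` shows that it is trivial
(`functionallyIndependent_pair`).
-/

namespace Finsler

open Set Filter Topology

/-! ### The induced charts of the tangent bundle -/

section Charts

variable {n : ℕ} {M : Type*} [TopologicalSpace M] [ChartedSpace (EuclideanSpace ℝ (Fin n)) M]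

lemma isOpen_slitDomain (p : M) : IsOpen (slitDomain n p) :=
  (isOpen_extChartAt_target p).prod isOpen_compl_singleton

lemma formFun_homogeneous (β : ∀ x : M, TangentSpace (𝓡 n) x →L[ℝ] ℝ) (x : M)
    (y : TangentSpace (𝓡 n) x) (c : ℝ) :
    formFun β (⟨x, c • y⟩ : TangentBundle (𝓡 n) M) = c * formFun β ⟨x, y⟩ :=
  (β x).map_smul c y

variable [IsManifold (𝓡 n) ∞ M]

lemma tangentChart_target (p : M) :
    (tangentChart (n := n) p).target = (extChartAt (𝓡 n) p).target ×ˢ univ := by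
  rw [tangentChart, FiberBundle.extChartAt_target]
  congr 1
  refine inter_eq_left.2 fun x hx => ?_
  have := (extChartAt (𝓡 n) p).map_target hx
  rwa [extChartAt_source] at this

/-- In the induced coordinates the fibres of `TM` are parametrized by linear isomorphisms. -/
lemma exists_tangentChart_symm_eq (p : M) {x : Vec n} (hx : x ∈ (extChartAt (𝓡 n) p).target) :
    ∃ A : Vec n ≃L[ℝ] TangentSpace (𝓡 n) ((extChartAt (𝓡 n) p).symm x),
      ∀ y, (tangentChart (n := n) p).symm (x, y) = ⟨(extChartAt (𝓡 n) p).symm x, A y⟩ := by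
  have hb : (extChartAt (𝓡 n) p).symm x ∈
      (trivializationAt (Vec n) (TangentSpace (𝓡 n)) p).baseSet := by
    have := (extChartAt (𝓡 n) p).map_target hx
    rwa [extChartAt_source] at this
  refine ⟨((trivializationAt (Vec n) (TangentSpace (𝓡 n)) p).continuousLinearEquivAt ℝ _ hb).symm,
    fun y => ?_⟩
  rw [tangentChart, FiberBundle.extChartAt]
  exact ((trivializationAt (Vec n) (TangentSpace (𝓡 n)) p).mk_symm hb y).symm

lemma tangentChart_symm_mem_slit {p : M} {z : Vec n × Vec n} (hz : z ∈ slitDomain n p) :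
    (tangentChart p).symm z ∈ slit n M := by
  obtain ⟨A, hA⟩ := exists_tangentChart_symm_eq p hz.1
  rw [show z = (z.1, z.2) from rfl, hA]
  exact fun h => hz.2 (A.map_eq_zero_iff.1 h)

lemma mem_tangentChart_target {p : M} {z : Vec n × Vec n} (hz : z ∈ slitDomain n p) :
    z ∈ (tangentChart (n := n) p).target := by
  rw [tangentChart_target]; exact ⟨hz.1, trivial⟩

lemma contMDiffOn_tangentChart_symm (p : M) :
    ContMDiffOn 𝓘(ℝ, Vec n × Vec n) (𝓡 n).tangent ∞ (tangentChart p).symm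
      (tangentChart (n := n) p).target := by
  have := contMDiffOn_extChartAt_symm (I := (𝓡 n).tangent) (n := ∞)
    (⟨p, 0⟩ : TangentBundle (𝓡 n) M)
  exact this

lemma contDiffOn_localExpr {f : TangentBundle (𝓡 n) M → ℝ}
    (hf : ContMDiffOn (𝓡 n).tangent 𝓘(ℝ, ℝ) ∞ f (slit n M)) (p : M) :
    ContDiffOn ℝ ∞ (localExpr f p) (slitDomain n p) :=
  (hf.comp ((contMDiffOn_tangentChart_symm p).mono fun _ hz => mem_tangentChart_target hz)
    fun _ hz => tangentChart_symm_mem_slit hz).contDiffOn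

lemma contDiffOn_localExpr_formFun {β : ∀ x : M, TangentSpace (𝓡 n) x →L[ℝ] ℝ}
    (hβ : IsSmoothForm β) (p : M) :
    ContDiffOn ℝ ∞ (localExpr (formFun β) p) ((extChartAt (𝓡 n) p).target ×ˢ univ) := by
  rw [← tangentChart_target]
  exact (hβ.comp_contMDiffOn (contMDiffOn_tangentChart_symm p)).contDiffOn

lemma isOpen_slit : IsOpen (slit n M) := by
  rw [isOpen_iff_mem_nhds]
  intro v hv
  set e := trivializationAt (Vec n) (TangentSpace (𝓡 n)) v.1
  have hsrc : v ∈ e.source := e.mem_source.2 (FiberBundle.mem_baseSet_trivializationAt' v.1)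
  have hmem : ∀ w ∈ e.source, w ∈ slit n M ↔ (e w).2 ≠ 0 := by
    intro w hw
    have hb := e.mem_source.1 hw
    have : (e w).2 = e.continuousLinearEquivAt ℝ _ hb w.2 := rfl
    rw [this, Ne, ContinuousLinearEquiv.map_eq_zero_iff]; rfl
  have h1 : ContinuousAt (fun w => (e w).2) v :=
    (e.continuousOn.continuousAt (e.open_source.mem_nhds hsrc)).snd
  filter_upwards [e.open_source.mem_nhds hsrc, h1.eventually_ne ((hmem v hsrc).1 hv)] with w hw h
  exact (hmem w hw).2 h

/-- Over the slit tangent bundle the differential is computed in the induced coordinates. -/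
lemma fderiv_localExpr {f : TangentBundle (𝓡 n) M → ℝ}
    (hf : ContMDiffOn (𝓡 n).tangent 𝓘(ℝ, ℝ) ∞ f (slit n M)) {p : M} {z : Vec n × Vec n}
    (hz : z ∈ slitDomain n p) :
    fderiv ℝ (localExpr f p) z = (differential f ((tangentChart p).symm z)).comp
      (mfderiv 𝓘(ℝ, Vec n × Vec n) (𝓡 n).tangent (tangentChart (n := n) p).symm z) := by
  rw [← mfderiv_eq_fderiv]
  have h1 := (hf.contMDiffAt (isOpen_slit.mem_nhds
    (tangentChart_symm_mem_slit hz))).mdifferentiableAt (by simp)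
  have h2 : MDifferentiableAt 𝓘(ℝ, Vec n × Vec n) (𝓡 n).tangent (tangentChart (n := n) p).symm z := by
    refine ((contMDiffOn_tangentChart_symm p).contMDiffAt ?_).mdifferentiableAt (by simp)
    rw [tangentChart_target]
    exact ((isOpen_extChartAt_target p).prod isOpen_univ).mem_nhds ⟨hz.1, trivial⟩
  exact mfderiv_comp z h1 h2

/-- In the induced coordinates a `1`-form is linear on the fibres. -/
lemma exists_localExpr_formFun_eq (β : ∀ x : M, TangentSpace (𝓡 n) x →L[ℝ] ℝ) (p : M) {x : Vec n}
    (hx : x ∈ (extChartAt (𝓡 n) p).target) :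
    ∃ b : Vec n →L[ℝ] ℝ, (∀ y, localExpr (formFun β) p (x, y) = b y) ∧
      (b = 0 ↔ β ((extChartAt (𝓡 n) p).symm x) = 0) := by
  obtain ⟨A, hA⟩ := exists_tangentChart_symm_eq p hx
  refine ⟨(β ((extChartAt (𝓡 n) p).symm x)).comp (A : Vec n →L[ℝ] _), fun y => ?_, ?_⟩
  · rw [localExpr, hA]; rfl
  · refine ⟨fun h => ?_, fun h => by rw [h]; rfl⟩
    ext v
    have h1 : β _ (A (A.symm v)) = 0 := DFunLike.congr_fun h (A.symm v)
    rw [A.apply_symm_apply] at h1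
    exact h1

lemma localExpr_homogeneous {f : TangentBundle (𝓡 n) M → ℝ}
    (hf : ∀ (x : M) (y : TangentSpace (𝓡 n) x) (c : ℝ), 0 < c →
      f (⟨x, c • y⟩ : TangentBundle (𝓡 n) M) = c * f (⟨x, y⟩ : TangentBundle (𝓡 n) M))
    (p : M) {z : Vec n × Vec n} (hz : z ∈ slitDomain n p) {c : ℝ} (hc : 0 < c) :
    localExpr f p (z.1, c • z.2) = c * localExpr f p z := by
  obtain ⟨A, hA⟩ := exists_tangentChart_symm_eq p hz.1
  have h2 : localExpr f p z = f ⟨_, A z.2⟩ := by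
    rw [← hA]; rfl
  rw [h2, ← hf _ _ c hc, localExpr, hA, map_smul]

end Charts

/-! ### Homogeneous functions and Euler–Lagrange equations on `ℝⁿ × ℝⁿ` -/

section LocalCalculus

variable {n : ℕ} {W : Type*} [NormedAddCommGroup W] [NormedSpace ℝ W]

lemma fderiv_dY {f : Vec n × Vec n → W} {z : Vec n × Vec n} (hf : ContDiffAt ℝ 2 f z)
    (w : Vec n) (v : Vec n × Vec n) :
    fderiv ℝ (dY w f) z v = fderiv ℝ (fderiv ℝ f) z v (0, w) := by
  have h : DifferentiableAt ℝ (fderiv ℝ f) z :=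
    (hf.fderiv_right (m := 1) (by norm_num)).differentiableAt (by norm_num)
  unfold dY
  rw [fderiv_clm_apply h (differentiableAt_const _)]
  simp

lemma dY_comm {f : Vec n × Vec n → W} {z : Vec n × Vec n} (hf : ContDiffAt ℝ 2 f z)
    (u w : Vec n) : dY u (dY w f) z = dY w (dY u f) z := by
  have hs : IsSymmSndFDerivAt ℝ f z := hf.isSymmSndFDerivAt (by simp)
  change fderiv ℝ (dY w f) z (0, u) = fderiv ℝ (dY u f) z (0, w)
  rw [fderiv_dY hf, fderiv_dY hf, hs]

lemma contDiffAt_dY {f : Vec n × Vec n → W} {z : Vec n × Vec n} (hf : ContDiffAt ℝ ∞ f z)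
    (w : Vec n) : ContDiffAt ℝ ∞ (dY w f) z :=
  (hf.fderiv_right (m := ∞) (by simp)).clm_apply contDiffAt_const

lemma dY_smul_add (f : Vec n × Vec n → W) (z : Vec n × Vec n) (c : ℝ) (u v : Vec n) :
    dY (u + c • v) f z = dY u f z + c • dY v f z := by
  simp only [dY]
  rw [← map_smul, ← map_add]; simp

/-- Euler's relation for positively `k`-homogeneous functions. -/
lemma dY_snd_of_homogeneous {f : Vec n × Vec n → W} {k : ℕ} {z : Vec n × Vec n}
    (hf : DifferentiableAt ℝ f z) (h : ∀ c : ℝ, 0 < c → f (z.1, c • z.2) = c ^ k • f z) :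
    dY z.2 f z = (k : ℝ) • f z := by
  have h1 : HasDerivAt (fun c : ℝ => (z.1, c • z.2)) ((0 : Vec n), z.2) 1 := by
    have := (hasDerivAt_const (1 : ℝ) z.1).prodMk ((hasDerivAt_id (1 : ℝ)).smul_const z.2)
    simpa using this
  have h2 : HasDerivAt (fun c : ℝ => f (z.1, c • z.2)) (fderiv ℝ f z (0, z.2)) 1 := by
    have hz : (z.1, (1 : ℝ) • z.2) = z := by simp
    have hf' : HasFDerivAt f (fderiv ℝ f z) (z.1, (1 : ℝ) • z.2) := by
      rw [hz]; exact hf.hasFDerivAt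
    exact hf'.comp_hasDerivAt (1 : ℝ) h1
  have h3 : HasDerivAt (fun c : ℝ => c ^ k • f z) ((k : ℝ) • f z) 1 := by
    simpa using (hasDerivAt_pow k (1 : ℝ)).smul_const (f z)
  refine h2.unique (h3.congr_of_eventuallyEq ?_)
  filter_upwards [lt_mem_nhds (zero_lt_one' ℝ)] with c hc using h c hc

/-- The derivative of Euler's relation `y^i ∂̇_i f = k f`. -/
lemma fderiv_dY_snd_of_homogeneous {f : Vec n × Vec n → W} {k : ℕ} {D : Set (Vec n × Vec n)}
    (hD : IsOpen D) (hf : ContDiffOn ℝ ∞ f D)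
    (h : ∀ z ∈ D, ∀ c : ℝ, 0 < c → f (z.1, c • z.2) = c ^ k • f z)
    {z : Vec n × Vec n} (hz : z ∈ D) (v : Vec n × Vec n) :
    fderiv ℝ (dY z.2 f) z v + dY v.2 f z = (k : ℝ) • fderiv ℝ f z v := by
  have hfz : ∀ z ∈ D, ContDiffAt ℝ ∞ f z := fun z hz => hf.contDiffAt (hD.mem_nhds hz)
  have h2 : DifferentiableAt ℝ (fderiv ℝ f) z :=
    ((hfz z hz).fderiv_right (m := ∞) (by simp)).differentiableAt (by simp)
  have h1 : DifferentiableAt ℝ f z := (hfz z hz).differentiableAt (by simp)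
  have he : (fun z' : Vec n × Vec n => fderiv ℝ f z' (0, z'.2)) =ᶠ[𝓝 z]
      fun z' => (k : ℝ) • f z' := by
    filter_upwards [hD.mem_nhds hz] with z' hz'
    exact dY_snd_of_homogeneous ((hfz z' hz').differentiableAt (by simp)) (h z' hz')
  have h3 : HasFDerivAt (fun z' : Vec n × Vec n => ((0 : Vec n), z'.2))
      ((0 : Vec n × Vec n →L[ℝ] Vec n).prod (ContinuousLinearMap.snd ℝ _ _)) z :=
    (hasFDerivAt_const _ _).prodMk hasFDerivAt_snd
  have h4 := DFunLike.congr_fun (he.fderiv_eq (𝕜 := ℝ)) v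
  rw [fderiv_clm_apply h2 h3.differentiableAt, h3.fderiv,
    fderiv_fun_const_smul h1 (k : ℝ)] at h4
  rw [fderiv_dY ((hfz z hz).of_le ENat.LEInfty.out), dY]
  refine Eq.trans ?_ h4
  simp [add_comm]

lemma fderiv_add_eval {f g : Vec n × Vec n → ℝ} {z : Vec n × Vec n} (hf : ContDiffAt ℝ ∞ f z)
    (hg : ContDiffAt ℝ ∞ g z) (v : Vec n × Vec n) :
    fderiv ℝ (fun z => f z + g z) z v = fderiv ℝ f z v + fderiv ℝ g z v := by
  rw [fderiv_fun_add (hf.differentiableAt (by simp)) (hg.differentiableAt (by simp))]; rfl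

lemma fderiv_dY_add {f g : Vec n × Vec n → ℝ} {z : Vec n × Vec n} (hf : ContDiffAt ℝ ∞ f z)
    (hg : ContDiffAt ℝ ∞ g z) (w : Vec n) (v : Vec n × Vec n) :
    fderiv ℝ (dY w fun z => f z + g z) z v = fderiv ℝ (dY w f) z v + fderiv ℝ (dY w g) z v := by
  have he : (dY w fun z => f z + g z) =ᶠ[𝓝 z] fun z => dY w f z + dY w g z := by
    filter_upwards [(hf.of_le (m := 1) (by simp)).eventually (by simp),
      (hg.of_le (m := 1) (by simp)).eventually (by simp)] with z' h1 h2
    simp only [dY]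
    rw [fderiv_fun_add (h1.differentiableAt (by simp)) (h2.differentiableAt (by simp))]; rfl
  rw [he.fderiv_eq, fderiv_fun_add ((contDiffAt_dY hf w).differentiableAt (by simp))
    ((contDiffAt_dY hg w).differentiableAt (by simp))]; rfl

/-- The Hessian of the restriction to a fibre is the vertical Hessian. -/
lemma fderiv_fderiv_slice {E : Vec n × Vec n → ℝ} {x y : Vec n} (hE : ContDiffAt ℝ ∞ E (x, y))
    (u w : Vec n) : fderiv ℝ (fderiv ℝ fun y => E (x, y)) y u w = dY u (dY w E) (x, y) := by
  have hc : ContinuousAt (fun y : Vec n => (x, y)) y := by fun_prop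
  have h1 : ∀ {k : Vec n × Vec n → ℝ} {y : Vec n}, DifferentiableAt ℝ k (x, y) →
      ∀ v, fderiv ℝ (fun y => k (x, y)) y v = dY v k (x, y) := fun hk v => by
    have h := (hk.hasFDerivAt.comp _ (hasFDerivAt_prodMk_right x _)).fderiv
    exact DFunLike.congr_fun h v
  have he : (fun y => fderiv ℝ (fun y => E (x, y)) y w) =ᶠ[𝓝 y] fun y => dY w E (x, y) := by
    filter_upwards [hc.eventually ((hE.of_le (m := 1) (by simp)).eventually (by simp))] with y' hy'
    exact h1 (hy'.differentiableAt (by simp)) w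
  have hslice : ContDiffAt ℝ ∞ (fun y => E (x, y)) y :=
    ContDiffAt.comp (f := fun y : Vec n => (x, y)) y hE (by fun_prop)
  have hd : DifferentiableAt ℝ (fderiv ℝ fun y => E (x, y)) y :=
    (hslice.fderiv_right (m := ∞) (by simp)).differentiableAt (by simp)
  have h2 := DFunLike.congr_fun (he.fderiv_eq (𝕜 := ℝ)) u
  rw [h1 ((contDiffAt_dY hE w).differentiableAt (by simp)),
    fderiv_clm_apply hd (differentiableAt_const _)] at h2
  rw [← h2]; simp

lemma dY_half_sq {f : Vec n × Vec n → ℝ} {z : Vec n × Vec n} (hf : DifferentiableAt ℝ f z)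
    (w : Vec n) : dY w (fun z => f z ^ 2 / 2) z = f z * dY w f z := by
  have h := ((hf.hasFDerivAt.pow 2).mul_const (1 / 2 : ℝ)).fderiv
  have : (fun z => f z ^ 2 / 2) = fun z => f z ^ 2 * (1 / 2 : ℝ) := by ext; ring
  rw [dY, this, h]
  simp [dY]; ring

lemma dX_half_sq {f : Vec n × Vec n → ℝ} {z : Vec n × Vec n} (hf : DifferentiableAt ℝ f z)
    (w : Vec n) : dX w (fun z => f z ^ 2 / 2) z = f z * dX w f z := by
  have h := ((hf.hasFDerivAt.pow 2).mul_const (1 / 2 : ℝ)).fderiv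
  have : (fun z => f z ^ 2 / 2) = fun z => f z ^ 2 * (1 / 2 : ℝ) := by ext; ring
  rw [dX, this, h]
  simp [dX]; ring

lemma fderiv_dY_half_sq {f : Vec n × Vec n → ℝ} {z : Vec n × Vec n} (hf : ContDiffAt ℝ ∞ f z)
    (w : Vec n) (v : Vec n × Vec n) :
    fderiv ℝ (dY w (fun z => f z ^ 2 / 2)) z v =
      f z * fderiv ℝ (dY w f) z v + fderiv ℝ f z v * dY w f z := by
  have he : dY w (fun z => f z ^ 2 / 2) =ᶠ[𝓝 z] fun z => f z * dY w f z := by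
    filter_upwards [(hf.of_le (m := 1) (by simp)).eventually (by simp)] with z' hz'
    exact dY_half_sq (hz'.differentiableAt (by simp)) w
  rw [he.fderiv_eq, fderiv_fun_mul (hf.differentiableAt (by simp))
    ((contDiffAt_dY hf w).differentiableAt (by simp))]
  simp; ring

/-- For a positive `1`-homogeneous `f`, the Euler–Lagrange equations of `f² / 2` along
`s = (y, η)` imply that `f` is constant along `s`, and the Euler–Lagrange equations of `f`. -/
lemma eulerLagrange_of_half_sq {f : Vec n × Vec n → ℝ} {D : Set (Vec n × Vec n)}
    (hD : IsOpen D) (hf : ContDiffOn ℝ ∞ f D)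
    (hhom : ∀ z ∈ D, ∀ c : ℝ, 0 < c → f (z.1, c • z.2) = c * f z)
    {z : Vec n × Vec n} (hz : z ∈ D) (hpos : 0 < f z) (η : Vec n)
    (h : ∀ w, fderiv ℝ (dY w (fun z => f z ^ 2 / 2)) z (z.2, η) =
      dX w (fun z => f z ^ 2 / 2) z) :
    fderiv ℝ f z (z.2, η) = 0 ∧ ∀ w, fderiv ℝ (dY w f) z (z.2, η) = dX w f z := by
  have hfz : ContDiffAt ℝ ∞ f z := hf.contDiffAt (hD.mem_nhds hz)
  have hd := hfz.differentiableAt (by simp)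
  have hhom' : ∀ z ∈ D, ∀ c : ℝ, 0 < c → f (z.1, c • z.2) = c ^ 1 • f z := by
    simpa using hhom
  have h' : ∀ w, f z * fderiv ℝ (dY w f) z (z.2, η) + fderiv ℝ f z (z.2, η) * dY w f z =
      f z * dX w f z := fun w => by
    rw [← fderiv_dY_half_sq hfz, h, dX_half_sq hd]
  have e1 : dY z.2 f z = f z := by
    simpa using dY_snd_of_homogeneous hd (hhom' z hz)
  have e2 := fderiv_dY_snd_of_homogeneous hD hf hhom' hz (z.2, η)
  have e3 : fderiv ℝ f z (z.2, η) = dX z.2 f z + dY η f z := by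
    rw [dX, dY, ← map_add]; simp
  have h0 : fderiv ℝ f z (z.2, η) = 0 := by
    have h1 := h' z.2
    rw [e1] at h1
    simp only [Nat.cast_one, one_smul] at e2
    have h2 : fderiv ℝ (dY z.2 f) z (z.2, η) = dX z.2 f z := by linarith
    rw [h2] at h1
    have : fderiv ℝ f z (z.2, η) * f z = 0 := by linarith
    exact (mul_eq_zero.1 this).resolve_right hpos.ne'
  refine ⟨h0, fun w => ?_⟩
  have h1 := h' w
  rw [h0, zero_mul, add_zero] at h1
  exact mul_left_cancel₀ hpos.ne' h1

/-- Converse of `eulerLagrange_of_half_sq`; neither positivity nor homogeneity is needed, so it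
applies to `1`-forms. -/
lemma half_sq_eulerLagrange {f : Vec n × Vec n → ℝ} {z s : Vec n × Vec n}
    (hf : ContDiffAt ℝ ∞ f z) (h0 : fderiv ℝ f z s = 0)
    (h1 : ∀ w, fderiv ℝ (dY w f) z s = dX w f z) (w : Vec n) :
    fderiv ℝ (dY w (fun z => f z ^ 2 / 2)) z s = dX w (fun z => f z ^ 2 / 2) z := by
  rw [fderiv_dY_half_sq hf, h0, h1, dX_half_sq (hf.differentiableAt (by simp))]; ring

/-- Rank of the metric tensor of a positive `1`-homogeneous `f`: since
`g_{ij} = f ∂̇_i ∂̇_j f + ∂̇_i f ∂̇_j f`, it has rank `n` if and only if the kernel of the vertical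
Hessian of `f` is spanned by `y`, so it depends on that Hessian only. -/
lemma nondegenerate_of_dY_dY_eq {f g : Vec n × Vec n → ℝ} {D : Set (Vec n × Vec n)}
    (hD : IsOpen D) (hf : ContDiffOn ℝ ∞ f D) (hg : ContDiffOn ℝ ∞ g D)
    (hfhom : ∀ z ∈ D, ∀ c : ℝ, 0 < c → f (z.1, c • z.2) = c * f z)
    (hghom : ∀ z ∈ D, ∀ c : ℝ, 0 < c → g (z.1, c • z.2) = c * g z)
    {z : Vec n × Vec n} (hz : z ∈ D) (hfpos : 0 < f z) (hgpos : 0 < g z)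
    (heq : ∀ u w, dY u (dY w g) z = dY u (dY w f) z)
    (hnd : ∀ u, (∀ w, dY u (dY w (fun z => f z ^ 2 / 2)) z = 0) → u = 0)
    (u : Vec n) (hu : ∀ w, dY u (dY w (fun z => g z ^ 2 / 2)) z = 0) : u = 0 := by
  have hfz : ContDiffAt ℝ ∞ f z := hf.contDiffAt (hD.mem_nhds hz)
  have hgz : ContDiffAt ℝ ∞ g z := hg.contDiffAt (hD.mem_nhds hz)
  have hH : ∀ {k : Vec n × Vec n → ℝ}, ContDiffAt ℝ ∞ k z → ∀ v w,
      dY v (dY w (fun z => k z ^ 2 / 2)) z = k z * dY v (dY w k) z + dY v k z * dY w k z :=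
    fun hk v w => fderiv_dY_half_sq hk w (0, v)
  have euler : ∀ {k : Vec n × Vec n → ℝ}, ContDiffAt ℝ ∞ k z →
      (∀ z ∈ D, ∀ c : ℝ, 0 < c → k (z.1, c • z.2) = c * k z) → dY z.2 k z = k z :=
    fun hk hhom => by
      simpa using dY_snd_of_homogeneous (k := 1) (hk.differentiableAt (by simp))
        (by simpa using hhom z hz)
  have hy : ∀ v, dY v (dY z.2 f) z = 0 := fun v => by
    have := fderiv_dY_snd_of_homogeneous (k := 1) hD hf (by simpa using hfhom) hz (0, v)
    simp only [Nat.cast_one, one_smul] at this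
    change dY v (dY z.2 f) z + dY v f z = dY v f z at this
    linarith
  have hgu : dY u g z = 0 := by
    have := hu z.2
    rw [hH hgz, heq, hy, euler hgz hghom, mul_zero, zero_add] at this
    exact (mul_eq_zero.1 this).resolve_right hgpos.ne'
  have hfu : ∀ w, dY u (dY w f) z = 0 := fun w => by
    have := hu w
    rw [hH hgz, hgu, zero_mul, add_zero, heq] at this
    exact (mul_eq_zero.1 this).resolve_left hgpos.ne'
  -- the component of `u` tangent to the level set of `f` is in the kernel of the metric of `f`
  have h0 : u + (-(dY u f z / f z)) • z.2 = 0 := by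
    refine hnd _ fun w => ?_
    rw [hH hfz, dY_smul_add, dY_smul_add, hfu, dY_comm (hfz.of_le ENat.LEInfty.out) z.2 w, hy,
      euler hfz hfhom]
    simp only [smul_eq_mul]
    field_simp
    ring
  have h1 : u = (dY u f z / f z) • z.2 := by
    rw [neg_smul] at h0; exact add_neg_eq_zero.1 h0
  have h2 : dY u f z / f z * g z = 0 := by
    have h3 := dY_smul_add g z (dY u f z / f z) 0 z.2
    rw [zero_add, ← h1, hgu, euler hgz hghom, show dY 0 g z = 0 from map_zero (fderiv ℝ g z),
      zero_add] at h3
    exact h3.symm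
  rw [h1, (mul_eq_zero.1 h2).resolve_right hgpos.ne', zero_smul]

end LocalCalculus

/-! ### Positive definiteness of Hessians of homogeneous functions -/

section PositiveDefinite

variable {V : Type*} [NormedAddCommGroup V] [InnerProductSpace ℝ V] [FiniteDimensional ℝ V]

open scoped RealInnerProductSpace in
/-- A positive `2`-homogeneous function has a point where its Hessian is positive definite: where
its restriction to the unit sphere attains its minimum `m`, since there it touches `m ‖y‖²` from
above. -/
lemma exists_hessian_pos [Nontrivial V] {e : V → ℝ} (he : ContDiffOn ℝ ∞ e {0}ᶜ)
    (hpos : ∀ y, y ≠ 0 → 0 < e y) (hhom : ∀ y, y ≠ 0 → ∀ c : ℝ, 0 < c → e (c • y) = c ^ 2 * e y) :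
    ∃ y, y ≠ 0 ∧ ∀ u, u ≠ 0 → 0 < fderiv ℝ (fderiv ℝ e) y u u := by
  have hsub : Metric.sphere (0 : V) 1 ⊆ {0}ᶜ := fun y hy h => by
    rw [mem_singleton_iff] at h; subst h; simp at hy
  obtain ⟨y, hy, hmin⟩ := (isCompact_sphere (0 : V) 1).exists_isMinOn
    (NormedSpace.sphere_nonempty.2 zero_le_one) (he.continuousOn.mono hsub)
  have hy1 : ‖y‖ = 1 := by simpa using hy
  have hy0 : y ≠ 0 := hsub hy
  have hge : ∀ v, v ≠ 0 → e y * ‖v‖ ^ 2 ≤ e v := fun v hv => by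
    have hv' : 0 < ‖v‖ := norm_pos_iff.2 hv
    have h1 : e y ≤ e (‖v‖⁻¹ • v) := hmin (by simp [norm_smul, hv])
    rw [hhom v hv _ (inv_pos.2 hv')] at h1
    calc e y * ‖v‖ ^ 2 ≤ (‖v‖⁻¹ ^ 2 * e v) * ‖v‖ ^ 2 := by gcongr
      _ = e v := by field_simp
  refine ⟨y, hy0, fun u hu => ?_⟩
  by_contra! hle
  have hez : ∀ v, v ≠ 0 → ContDiffAt ℝ ∞ e v := fun v hv =>
    he.contDiffAt (isOpen_compl_singleton.mem_nhds hv)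
  have hline : ∀ t : ℝ, HasDerivAt (fun t : ℝ => y + t • u) u t := fun t => by
    simpa using ((hasDerivAt_id t).smul_const u).const_add y
  have hne : ∀ᶠ t : ℝ in 𝓝 0, y + t • u ≠ 0 := by
    refine (hline 0).continuousAt.eventually_ne ?_
    simpa using hy0
  set φ : ℝ → ℝ := fun t => e (y + t • u) - e y * (1 + 2 * t * ⟪y, u⟫ + t ^ 2 * ‖u‖ ^ 2) with hφ
  have hnorm : ∀ t : ℝ, ‖y + t • u‖ ^ 2 = 1 + 2 * t * ⟪y, u⟫ + t ^ 2 * ‖u‖ ^ 2 := fun t => by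
    rw [norm_add_sq_real, hy1, inner_smul_right, norm_smul, mul_pow, Real.norm_eq_abs, sq_abs]
    ring
  have hφ0 : φ 0 = 0 := by simp [hφ]
  have hφnonneg : ∀ᶠ t in 𝓝 (0 : ℝ), φ 0 ≤ φ t := by
    filter_upwards [hne] with t ht
    have := hge _ ht
    rw [hφ0]; simp only [hφ]; rw [← hnorm]; linarith
  have hd : ∀ᶠ t in 𝓝 (0 : ℝ), HasDerivAt φ
      (fderiv ℝ e (y + t • u) u - e y * (2 * ⟪y, u⟫ + 2 * t * ‖u‖ ^ 2)) t := by
    filter_upwards [hne] with t ht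
    have h1 := ((hez _ ht).differentiableAt (by simp)).hasFDerivAt.comp_hasDerivAt t (hline t)
    have h2 : HasDerivAt (fun t : ℝ => e y * (1 + 2 * t * ⟪y, u⟫ + t ^ 2 * ‖u‖ ^ 2))
        (e y * (2 * ⟪y, u⟫ + 2 * t * ‖u‖ ^ 2)) t := by
      have h3 := (((hasDerivAt_id t).const_mul 2).mul_const ⟪y, u⟫).const_add 1
      have h4 := (hasDerivAt_pow 2 t).mul_const (‖u‖ ^ 2)
      simpa using (h3.add h4).const_mul (e y)
    exact h1.sub h2
  have hd1 : deriv φ =ᶠ[𝓝 0] fun t =>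
      fderiv ℝ e (y + t • u) u - e y * (2 * ⟪y, u⟫ + 2 * t * ‖u‖ ^ 2) := by
    filter_upwards [hd] with t ht using ht.deriv
  have hd2 : HasDerivAt (fun t : ℝ =>
      fderiv ℝ e (y + t • u) u - e y * (2 * ⟪y, u⟫ + 2 * t * ‖u‖ ^ 2))
      (fderiv ℝ (fderiv ℝ e) y u u - e y * (2 * ‖u‖ ^ 2)) 0 := by
    have h0 : DifferentiableAt ℝ (fderiv ℝ e) (y + (0 : ℝ) • u) := by
      rw [zero_smul, add_zero]
      exact ((hez y hy0).fderiv_right (m := ∞) (by simp)).differentiableAt (by simp)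
    have h00 : HasDerivAt (fun t : ℝ => fderiv ℝ e (y + t • u))
        (fderiv ℝ (fderiv ℝ e) (y + (0 : ℝ) • u) u) 0 :=
      h0.hasFDerivAt.comp_hasDerivAt (0 : ℝ) (hline 0)
    have h1 : HasDerivAt (fun t : ℝ => fderiv ℝ e (y + t • u) u)
        (fderiv ℝ (fderiv ℝ e) y u u) 0 := by
      rw [zero_smul, add_zero] at h00
      simpa using h00.clm_apply (hasDerivAt_const (0 : ℝ) u)
    have h2 : HasDerivAt (fun t : ℝ => e y * (2 * ⟪y, u⟫ + 2 * t * ‖u‖ ^ 2))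
        (e y * (2 * ‖u‖ ^ 2)) 0 := by
      have h3 := (((hasDerivAt_id (0 : ℝ)).const_mul 2).mul_const (‖u‖ ^ 2)).const_add (2 * ⟪y, u⟫)
      simpa using h3.const_mul (e y)
    exact h1.sub h2
  have hdd : deriv (deriv φ) 0 = fderiv ℝ (fderiv ℝ e) y u u - e y * (2 * ‖u‖ ^ 2) := by
    rw [hd1.deriv_eq, hd2.deriv]
  have hneg : deriv (deriv φ) 0 < 0 := by
    rw [hdd]
    have := mul_pos (hpos y hy0) (mul_pos two_pos (pow_pos (norm_pos_iff.2 hu) 2))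
    linarith
  -- a local minimum with negative second derivative is also a local maximum, so `φ` is locally
  -- constant and its second derivative vanishes
  have hmax := isLocalMax_of_deriv_deriv_neg hneg (IsLocalMin.deriv_eq_zero hφnonneg)
    hd.self_of_nhds.continuousAt
  have hconst : φ =ᶠ[𝓝 0] fun _ => φ 0 := by
    filter_upwards [hmax, hφnonneg] with t h1 h2 using le_antisymm h1 h2
  have : deriv (deriv φ) 0 = 0 := by
    rw [hconst.deriv.deriv_eq]; simp
  exact hneg.ne this

/-- A continuous family of nondegenerate symmetric forms over the connected set of nonzero vectors
is positive definite everywhere once it is so at one vector. -/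
lemma pos_of_exists_pos (hV : 1 < Module.finrank ℝ V) {H : V → V →L[ℝ] V →L[ℝ] ℝ}
    (hH : ContinuousOn H {0}ᶜ) (hsymm : ∀ y, y ≠ 0 → ∀ u w, H y u w = H y w u)
    (hnd : ∀ y, y ≠ 0 → ∀ u, (∀ w, H y u w = 0) → u = 0)
    (hex : ∃ y, y ≠ 0 ∧ ∀ u, u ≠ 0 → 0 < H y u u) {y : V} (hy : y ≠ 0) {u : V} (hu : u ≠ 0) :
    0 < H y u u := by
  -- the set `P` of points of definiteness is open, and closed in the connected set `{0}ᶜ`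
  have hconn : IsPreconnected ({0}ᶜ : Set V) :=
    (isConnected_compl_singleton_of_one_lt_rank
      (by rw [← Module.finrank_eq_rank]; exact_mod_cast hV) 0).isPreconnected
  set P : Set V := {y | y ≠ 0 ∧ ∀ u, u ≠ 0 → 0 < H y u u} with hP
  have hHat : ∀ y, y ≠ 0 → ContinuousAt H y := fun y hy =>
    hH.continuousAt (isOpen_compl_singleton.mem_nhds hy)
  have hopen : IsOpen P := by
    rw [isOpen_iff_mem_nhds]
    rintro y ⟨hy, hpos⟩
    have hev : ∀ᶠ y' in 𝓝 y, ∀ u ∈ Metric.sphere (0 : V) 1, 0 < H y' u u := by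
      refine (isCompact_sphere (0 : V) 1).eventually_forall_of_forall_eventually fun u hu => ?_
      have hu0 : u ≠ 0 := by rintro rfl; simp at hu
      have hc : ContinuousAt (fun q : V × V => H q.1 q.2 q.2) (y, u) := by
        have h1 : ContinuousAt (fun q : V × V => H q.1) (y, u) :=
          ContinuousAt.comp (f := Prod.fst) (x := (y, u)) (hHat y hy) continuousAt_fst
        exact (h1.clm_apply continuousAt_snd).clm_apply continuousAt_snd
      have := hc.eventually (lt_mem_nhds (hpos u hu0))
      exact this
    filter_upwards [hev, isOpen_compl_singleton.mem_nhds hy] with y' h1 h2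
    refine ⟨h2, fun u hu => ?_⟩
    have hu' : 0 < ‖u‖ := norm_pos_iff.2 hu
    have h3 := h1 (‖u‖⁻¹ • u) (by simp [norm_smul, hu])
    simp only [map_smul, FunLike.coe_smul, Pi.smul_apply, smul_eq_mul] at h3
    rw [← mul_assoc] at h3
    exact (mul_pos_iff_of_pos_left (mul_pos (inv_pos.2 hu') (inv_pos.2 hu'))).1 h3
  have hclosed : closure P ∩ {0}ᶜ ⊆ P := by
    rintro y ⟨hyc, hy⟩
    have hnonneg : ∀ u, 0 ≤ H y u u := fun u => by
      have hcu : ContinuousAt (fun y => H y u u) y :=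
        ((hHat y hy).clm_apply continuousAt_const).clm_apply continuousAt_const
      have := mem_closure_iff_frequently.1 hyc
      refine ge_of_tendsto_of_frequently hcu.tendsto (this.mono fun y' hy' => ?_)
      by_cases hu : u = 0
      · simp [hu]
      · exact (hy'.2 u hu).le
    refine ⟨hy, fun u hu => (hnonneg u).lt_of_ne' fun h0 => hu (hnd y hy u fun w => ?_)⟩
    -- a null vector of a positive semidefinite form is in its kernel
    have hq : ∀ t : ℝ, 0 ≤ H y w w * (t * t) + 2 * H y u w * t + 0 := fun t => by
      have := hnonneg (u + t • w)
      simp only [map_add, map_smul, FunLike.coe_add, FunLike.coe_smul, Pi.add_apply,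
        Pi.smul_apply, smul_eq_mul, h0, hsymm y hy w u] at this
      linarith
    have := discrim_le_zero hq
    rw [discrim] at this
    nlinarith [sq_nonneg (H y u w)]
  exact (hconn.subset_of_closure_inter_subset hopen
    (by obtain ⟨y, hy, h⟩ := hex; exact ⟨y, hy, hy, h⟩) hclosed hy).2 u hu

/-- The Hessian of a positive `2`-homogeneous function on the nonzero vectors of a space of
dimension at least two is positive definite as soon as it is everywhere nondegenerate. -/
lemma hessian_pos_of_nondegenerate (hV : 1 < Module.finrank ℝ V) {e : V → ℝ}
    (he : ContDiffOn ℝ ∞ e {0}ᶜ) (hpos : ∀ y, y ≠ 0 → 0 < e y)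
    (hhom : ∀ y, y ≠ 0 → ∀ c : ℝ, 0 < c → e (c • y) = c ^ 2 * e y)
    (hnd : ∀ y, y ≠ 0 → ∀ u, (∀ w, fderiv ℝ (fderiv ℝ e) y u w = 0) → u = 0)
    {y : V} (hy : y ≠ 0) {u : V} (hu : u ≠ 0) : 0 < fderiv ℝ (fderiv ℝ e) y u u := by
  have : Nontrivial V := Module.nontrivial_of_finrank_pos (R := ℝ) (by omega)
  have hez : ∀ v, v ≠ 0 → ContDiffAt ℝ ∞ e v := fun v hv =>
    he.contDiffAt (isOpen_compl_singleton.mem_nhds hv)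
  refine pos_of_exists_pos hV (fun y hy => ?_) (fun y hy u w => ?_) hnd
    (exists_hessian_pos he hpos hhom) hy hu
  · exact (((hez y hy).fderiv_right (m := ∞) (by simp)).fderiv_right
      (m := ∞) (by simp)).continuousAt.continuousWithinAt
  · exact ((hez y hy).isSymmSndFDerivAt (by simpa using ENat.LEInfty.out)) u w

end PositiveDefinite

/-! ### Parallel `1`-forms in coordinates -/

section LocalForms

variable {n : ℕ} {O : Set (Vec n)} {B : Vec n × Vec n → ℝ} {G : Vec n × Vec n → Vec n}

lemma dY_of_linear (hO : IsOpen O) (hB : ContDiffOn ℝ ∞ B (O ×ˢ univ))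
    (hlin : ∀ x ∈ O, ∃ b : Vec n →L[ℝ] ℝ, ∀ y, B (x, y) = b y) {z : Vec n × Vec n}
    (hz : z.1 ∈ O) (w : Vec n) : dY w B z = B (z.1, w) := by
  obtain ⟨b, hb⟩ := hlin z.1 hz
  have hd : HasFDerivAt B (fderiv ℝ B z) (z.1, z.2) :=
    ((hB.contDiffAt ((hO.prod isOpen_univ).mem_nhds ⟨hz, trivial⟩)).differentiableAt
      (by simp)).hasFDerivAt
  have h1 : HasFDerivAt (fun y => B (z.1, y)) ((fderiv ℝ B z).comp (ContinuousLinearMap.inr ℝ _ _))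
      z.2 := hd.comp z.2 (hasFDerivAt_prodMk_right z.1 z.2)
  have h2 : HasFDerivAt (fun y => B (z.1, y)) b z.2 := by
    simpa only [hb] using b.hasFDerivAt
  have := DFunLike.congr_fun (h1.unique h2) w
  rw [hb, ← this]; rfl

lemma fderiv_dY_of_linear (hO : IsOpen O) (hB : ContDiffOn ℝ ∞ B (O ×ˢ univ))
    (hlin : ∀ x ∈ O, ∃ b : Vec n →L[ℝ] ℝ, ∀ y, B (x, y) = b y) {z : Vec n × Vec n}
    (hz : z.1 ∈ O) (w : Vec n) (v : Vec n × Vec n) :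
    fderiv ℝ (dY w B) z v = dX v.1 B (z.1, w) := by
  have he : dY w B =ᶠ[𝓝 z] fun z => B (z.1, w) := by
    filter_upwards [continuousAt_fst.preimage_mem_nhds (hO.mem_nhds hz)] with z' hz'
    exact dY_of_linear hO hB hlin hz' w
  have hd : HasFDerivAt B (fderiv ℝ B (z.1, w)) (z.1, w) :=
    ((hB.contDiffAt (x := (z.1, w)) ((hO.prod isOpen_univ).mem_nhds ⟨hz, trivial⟩)).differentiableAt
      (by simp)).hasFDerivAt
  have h1 : HasFDerivAt (fun z : Vec n × Vec n => (z.1, w))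
      ((ContinuousLinearMap.fst ℝ _ _).prod (0 : Vec n × Vec n →L[ℝ] Vec n)) z :=
    hasFDerivAt_fst.prodMk (hasFDerivAt_const _ _)
  have h2 : HasFDerivAt (fun z : Vec n × Vec n => B (z.1, w)) _ z := hd.comp z h1
  rw [he.fderiv_eq, h2.fderiv]
  rfl

lemma dY_dY_of_linear (hO : IsOpen O) (hB : ContDiffOn ℝ ∞ B (O ×ˢ univ))
    (hlin : ∀ x ∈ O, ∃ b : Vec n →L[ℝ] ℝ, ∀ y, B (x, y) = b y) {z : Vec n × Vec n}
    (hz : z.1 ∈ O) (u w : Vec n) : dY u (dY w B) z = 0 := by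
  rw [dY, fderiv_dY_of_linear hO hB hlin hz]
  exact map_zero (fderiv ℝ B (z.1, w))

/-- A parallel `1`-form is constant along the geodesic spray `y^i ∂_i - 2 G^i ∂̇_i` and is a closed
form, so that it satisfies the Euler–Lagrange equations along the spray. -/
lemma eulerLagrange_of_parallel (hO : IsOpen O) (hB : ContDiffOn ℝ ∞ B (O ×ˢ univ))
    (hlin : ∀ x ∈ O, ∃ b : Vec n →L[ℝ] ℝ, ∀ y, B (x, y) = b y)
    (hG : ContDiffOn ℝ ∞ G (O ×ˢ {0}ᶜ))
    (hhom : ∀ z ∈ O ×ˢ ({0}ᶜ : Set (Vec n)), ∀ c : ℝ, 0 < c → G (z.1, c • z.2) = c ^ 2 • G z)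
    (hpar : ∀ z ∈ O ×ˢ ({0}ᶜ : Set (Vec n)), ∀ u v,
      dX v B (z.1, u) - B (z.1, dY u (dY v G) z) = 0)
    {z : Vec n × Vec n} (hz : z ∈ O ×ˢ ({0}ᶜ : Set (Vec n))) :
    fderiv ℝ B z (z.2, -(2 : ℝ) • G z) = 0 ∧
      ∀ w, fderiv ℝ (dY w B) z (z.2, -(2 : ℝ) • G z) = dX w B z := by
  have hD : IsOpen (O ×ˢ ({0}ᶜ : Set (Vec n))) := hO.prod isOpen_compl_singleton
  have hGz : ContDiffAt ℝ ∞ G z := hG.contDiffAt (hD.mem_nhds hz)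
  have hX : ∀ u v, dX v B (z.1, u) = B (z.1, dY u (dY v G) z) := fun u v =>
    sub_eq_zero.1 (hpar z hz u v)
  obtain ⟨b, hb⟩ := hlin z.1 hz.1
  constructor
  · have e1 : dY z.2 G z = (2 : ℝ) • G z := by
      simpa using dY_snd_of_homogeneous (hGz.differentiableAt (by simp)) (hhom z hz)
    have e2 : dY z.2 (dY z.2 G) z = (2 : ℝ) • G z := by
      have := fderiv_dY_snd_of_homogeneous hD hG hhom hz (0, z.2)
      change dY z.2 (dY z.2 G) z + dY z.2 G z = _ • dY z.2 G z at this
      rw [Nat.cast_ofNat, two_smul ℝ (dY z.2 G z), add_left_inj] at this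
      rw [this, e1]
    have e3 : fderiv ℝ B z (z.2, -(2 : ℝ) • G z) = dX z.2 B (z.1, z.2) + dY (-(2 : ℝ) • G z) B z := by
      rw [dX, dY, ← map_add]; simp
    rw [e3, hX, e2, dY_of_linear hO hB hlin hz.1, hb, hb, ← map_add]
    simp
  · intro w
    rw [fderiv_dY_of_linear hO hB hlin hz.1, hX, dY_comm (hGz.of_le ENat.LEInfty.out), ← hX]

/-- For a parallel `1`-form, `b_h G^h_{ijk} = ∂̇_k (b_h G^h_{ij}) = ∂̇_k ∂_j b_i = 0`. -/
lemma dY_berwald_of_parallel (hO : IsOpen O) (hB : ContDiffOn ℝ ∞ B (O ×ˢ univ))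
    (hlin : ∀ x ∈ O, ∃ b : Vec n →L[ℝ] ℝ, ∀ y, B (x, y) = b y)
    (hG : ContDiffOn ℝ ∞ G (O ×ˢ {0}ᶜ))
    (hpar : ∀ z ∈ O ×ˢ ({0}ᶜ : Set (Vec n)), ∀ u v,
      dX v B (z.1, u) - B (z.1, dY u (dY v G) z) = 0)
    {z : Vec n × Vec n} (hz : z ∈ O ×ˢ ({0}ᶜ : Set (Vec n))) (u v w : Vec n) :
    dY (dY w (dY u (dY v G)) z) B z = 0 := by
  have hD : IsOpen (O ×ˢ ({0}ᶜ : Set (Vec n))) := hO.prod isOpen_compl_singleton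
  have hGz : ContDiffAt ℝ ∞ G z := hG.contDiffAt (hD.mem_nhds hz)
  obtain ⟨b, hb⟩ := hlin z.1 hz.1
  rw [dY_of_linear hO hB hlin hz.1, hb]
  have hd : HasFDerivAt (dY u (dY v G)) (fderiv ℝ (dY u (dY v G)) z) (z.1, z.2) :=
    ((contDiffAt_dY (contDiffAt_dY hGz v) u).differentiableAt (by simp)).hasFDerivAt
  have h1 : HasFDerivAt (fun y => b (dY u (dY v G) (z.1, y))) _ z.2 :=
    b.hasFDerivAt.comp z.2 (hd.comp z.2 (hasFDerivAt_prodMk_right z.1 z.2))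
  have h2 : HasFDerivAt (fun y => b (dY u (dY v G) (z.1, y))) (0 : Vec n →L[ℝ] ℝ) z.2 := by
    refine (hasFDerivAt_const (dX v B (z.1, u)) z.2).congr_of_eventuallyEq ?_
    filter_upwards [isOpen_compl_singleton.mem_nhds hz.2] with y hy
    rw [← hb]
    exact (sub_eq_zero.1 (hpar (z.1, y) ⟨hz.1, hy⟩ u v)).symm
  exact DFunLike.congr_fun (h1.unique h2) w

/-- Unique continuation for parallel `1`-forms: along a segment issuing from a zero, the form solves
a homogeneous linear differential equation. -/
lemma eventually_eq_zero_of_parallel (hO : IsOpen O) (hB : ContDiffOn ℝ ∞ B (O ×ˢ univ))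
    (hlin : ∀ x ∈ O, ∃ b : Vec n →L[ℝ] ℝ, ∀ y, B (x, y) = b y)
    (hG : ContDiffOn ℝ ∞ G (O ×ˢ {0}ᶜ))
    (hpar : ∀ z ∈ O ×ˢ ({0}ᶜ : Set (Vec n)), ∀ u v,
      dX v B (z.1, u) - B (z.1, dY u (dY v G) z) = 0)
    {x₀ y₀ : Vec n} (hx₀ : x₀ ∈ O) (hy₀ : y₀ ≠ 0) (h0 : ∀ u, B (x₀, u) = 0) :
    ∀ᶠ x in 𝓝 x₀, ∀ u, B (x, u) = 0 := by
  have hD : IsOpen (O ×ˢ ({0}ᶜ : Set (Vec n))) := hO.prod isOpen_compl_singleton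
  have hGz : ∀ x ∈ O, ContDiffAt ℝ ∞ G (x, y₀) := fun x hx =>
    hG.contDiffAt (hD.mem_nhds ⟨hx, hy₀⟩)
  set K : ℝ := ‖fderiv ℝ (fderiv ℝ G) (x₀, y₀)‖ + 1 with hK
  have hbound : ∀ᶠ x in 𝓝 x₀, ‖fderiv ℝ (fderiv ℝ G) (x, y₀)‖ < K := by
    have hc := (((hGz x₀ hx₀).fderiv_right (m := ∞) (by simp)).fderiv_right
      (m := ∞) (by simp)).continuousAt.norm
    have hc' : ContinuousAt (fun x => ‖fderiv ℝ (fderiv ℝ G) (x, y₀)‖) x₀ :=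
      ContinuousAt.comp (f := fun x => (x, y₀)) hc (by fun_prop)
    exact hc'.eventually (gt_mem_nhds (lt_add_one _))
  obtain ⟨r, hr, hball⟩ := Metric.eventually_nhds_iff_ball.1 (hbound.and (hO.mem_nhds hx₀))
  filter_upwards [Metric.ball_mem_nhds x₀ hr] with x hx
  set γ : ℝ → Vec n := fun t => x₀ + t • (x - x₀) with hγ
  have hγ' : ∀ t, HasDerivAt γ (x - x₀) t := fun t => by
    have h := ((hasDerivAt_id t).smul_const (x - x₀)).const_add x₀
    rwa [one_smul] at h
  have hγball : ∀ t ∈ Icc (0 : ℝ) 1, γ t ∈ Metric.ball x₀ r := fun t ht =>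
    (convex_ball x₀ r).add_smul_sub_mem (Metric.mem_ball_self hr) hx ht
  have hBz : ∀ x ∈ O, ∀ y, ContDiffAt ℝ ∞ B (x, y) := fun x hx y =>
    hB.contDiffAt ((hO.prod isOpen_univ).mem_nhds ⟨hx, trivial⟩)
  -- the covector at `γ t`, written as a vertical derivative so that its smoothness in `t` is clear
  set f : ℝ → Vec n →L[ℝ] ℝ := fun t =>
    (fderiv ℝ B (γ t, 0)).comp (ContinuousLinearMap.inr ℝ (Vec n) (Vec n)) with hf
  have hfval : ∀ t, γ t ∈ O → ∀ u, f t u = B (γ t, u) := fun t ht u =>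
    dY_of_linear hO hB hlin (z := (γ t, 0)) ht u
  have hfd : ∀ t, γ t ∈ O → DifferentiableAt ℝ f t := fun t ht => by
    have h1 : DifferentiableAt ℝ (fderiv ℝ B) (γ t, 0) :=
      ((hBz _ ht 0).fderiv_right (m := ∞) (by simp)).differentiableAt (by simp)
    have h2 : DifferentiableAt ℝ (fun t => (γ t, (0 : Vec n))) t :=
      (hγ' t).differentiableAt.prodMk (differentiableAt_const _)
    have h3 : DifferentiableAt ℝ (fun t => fderiv ℝ B (γ t, 0)) t :=
      DifferentiableAt.comp (f := fun t => (γ t, (0 : Vec n))) t h1 h2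
    exact h3.clm_comp (differentiableAt_const _)
  have hderiv : ∀ t, γ t ∈ O → ∀ u,
      deriv f t u = f t (fderiv ℝ (fderiv ℝ G) (γ t, y₀) (0, u) (0, x - x₀)) := by
    intro t ht u
    have h1 : HasDerivAt (fun t => f t u) (deriv f t u) t := by
      simpa using (hfd t ht).hasDerivAt.clm_apply (hasDerivAt_const t u)
    have h2 : HasDerivAt (fun t => B (γ t, u)) (fderiv ℝ B (γ t, u) (x - x₀, 0)) t :=
      (((hBz _ ht u).differentiableAt (by simp)).hasFDerivAt).comp_hasDerivAt t
        ((hγ' t).prodMk (hasDerivAt_const t u))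
    have h3 : (fun t => f t u) =ᶠ[𝓝 t] fun t => B (γ t, u) := by
      filter_upwards [(hγ' t).continuousAt.preimage_mem_nhds (hO.mem_nhds ht)] with t' ht'
      exact hfval t' ht' u
    rw [h1.unique (h2.congr_of_eventuallyEq h3), hfval t ht,
      ← fderiv_dY ((hGz _ ht).of_le ENat.LEInfty.out)]
    exact sub_eq_zero.1 (hpar (γ t, y₀) ⟨ht, hy₀⟩ u (x - x₀))
  have hzero := eq_zero_of_abs_deriv_le_mul_abs_self_of_eq_zero_right (f := f) (f' := deriv f)
    (K := K * ‖x - x₀‖) (a := 0) (b := 1)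
    (fun t ht => (hfd t (hball _ (hγball t ht)).2).continuousAt.continuousWithinAt)
    (fun t ht => (hfd t (hball _ (hγball t ⟨ht.1, ht.2.le⟩)).2).hasDerivAt.hasDerivWithinAt)
    (by
      have hγ0 : γ 0 = x₀ := by simp [hγ]
      ext u
      rw [hfval 0 (by rwa [hγ0]), hγ0, h0]; rfl)
    (fun t ht => by
      obtain ⟨h1, h2⟩ := hball _ (hγball t ⟨ht.1, ht.2.le⟩)
      refine ContinuousLinearMap.opNorm_le_bound _ (by positivity) fun u => ?_
      rw [hderiv t h2]
      have e0 : ‖fderiv ℝ (fderiv ℝ G) (γ t, y₀) (0, u) (0, x - x₀)‖ ≤ K * ‖u‖ * ‖x - x₀‖ := by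
        refine (ContinuousLinearMap.le_opNorm₂ _ _ _).trans ?_
        rw [Prod.norm_mk, Prod.norm_mk, norm_zero, max_eq_right (norm_nonneg _),
          max_eq_right (norm_nonneg _)]
        gcongr
      calc _ ≤ ‖f t‖ * _ := (f t).le_opNorm _
        _ ≤ ‖f t‖ * (K * ‖u‖ * ‖x - x₀‖) := by gcongr
        _ = _ := by ring)
  intro u
  have h1 : γ 1 = x := by simp [hγ]
  have h2 := hfval 1 (hball _ (hγball 1 ⟨zero_le_one, le_rfl⟩)).2 u
  rw [hzero 1 ⟨zero_le_one, le_rfl⟩, h1] at h2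
  exact h2.symm

end LocalForms

/-! ### Zeros of vertical derivatives -/

section LocalIndependence

variable {n : ℕ}

/-- A nonzero linear form does not vanish identically on a nonempty open set. -/
lemma exists_apply_ne_zero_of_mem_nhds {V : Type*} [NormedAddCommGroup V] [NormedSpace ℝ V]
    {b : V →L[ℝ] ℝ} (hb : b ≠ 0) {y : V} {N : Set V} (hN : N ∈ 𝓝 y) : ∃ y' ∈ N, b y' ≠ 0 := by
  by_contra! h
  obtain ⟨w, hw⟩ : ∃ w, b w ≠ 0 := by
    by_contra! h'; exact hb (ContinuousLinearMap.ext h')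
  have hc : ContinuousAt (fun t : ℝ => y + t • w) 0 := by fun_prop
  have h1 : ∀ᶠ t : ℝ in 𝓝 0, y + t • w ∈ N := hc.preimage_mem_nhds (by simpa using hN)
  obtain ⟨t, ht, ht0⟩ := (((h1.filter_mono nhdsWithin_le_nhds).and
    (self_mem_nhdsWithin : ({0}ᶜ : Set ℝ) ∈ 𝓝[≠] 0))).exists
  have h2 := h _ ht
  rw [map_add, h y (mem_of_mem_nhds hN), map_smul, zero_add, smul_eq_mul] at h2
  exact (mul_ne_zero ht0 hw) h2

/-- If the metric of `f` is nondegenerate and `u ≠ 0`, then `u^i ∂̇_i f` does not vanish identically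
on any open subset of a fibre; it is nonzero at points where a given nonzero `1`-form is nonzero. -/
lemma exists_dY_ne_zero {f : Vec n × Vec n → ℝ} {D : Set (Vec n × Vec n)} (hD : IsOpen D)
    (hf : ContDiffOn ℝ ∞ f D) {x u : Vec n} (hu : u ≠ 0)
    (hnd : ∀ z ∈ D, ∀ u, (∀ w, dY u (dY w (fun z => f z ^ 2 / 2)) z = 0) → u = 0)
    {b : Vec n →L[ℝ] ℝ} (hb : b ≠ 0) {y : Vec n} {N : Set (Vec n × Vec n)} (hND : N ⊆ D)
    (hN : IsOpen N) (hy : (x, y) ∈ N) : ∃ y', (x, y') ∈ N ∧ b y' ≠ 0 ∧ dY u f (x, y') ≠ 0 := by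
  have hc : Continuous fun y : Vec n => (x, y) := by fun_prop
  obtain ⟨y₁, hy₁, hb₁⟩ := exists_apply_ne_zero_of_mem_nhds hb
    (hc.continuousAt.preimage_mem_nhds (hN.mem_nhds hy))
  by_contra! h
  have hzero : ∀ᶠ y' in 𝓝 y₁, dY u (fun z => f z ^ 2 / 2) (x, y') = 0 := by
    filter_upwards [(hN.preimage hc).mem_nhds hy₁,
      b.continuous.continuousAt.eventually_ne hb₁] with y' h1 h2
    rw [dY_half_sq ((hf.contDiffAt (hD.mem_nhds (hND h1))).differentiableAt (by simp)),
      h y' h1 h2, mul_zero]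
  have hfz : ContDiffAt ℝ ∞ f (x, y₁) := hf.contDiffAt (hD.mem_nhds (hND hy₁))
  have hE : ContDiffAt ℝ ∞ (fun z => f z ^ 2 / 2) (x, y₁) := (hfz.pow 2).div_const 2
  refine hu (hnd _ (hND hy₁) u fun w => ?_)
  rw [dY_comm (hE.of_le ENat.LEInfty.out)]
  have hd : HasFDerivAt (dY u (fun z => f z ^ 2 / 2)) _ (x, y₁) :=
    ((contDiffAt_dY hE u).differentiableAt (by simp)).hasFDerivAt
  have h1 := (hd.comp y₁ (hasFDerivAt_prodMk_right x y₁)).unique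
    ((hasFDerivAt_const (0 : ℝ) y₁).congr_of_eventuallyEq hzero)
  exact DFunLike.congr_fun h1 w

end LocalIndependence

/-! ### Finsler functions and parallel `1`-forms on a manifold -/

section Manifold

variable {n : ℕ} {M : Type*} [TopologicalSpace M] [ChartedSpace (EuclideanSpace ℝ (Fin n)) M]
  [IsManifold (𝓡 n) ∞ M] {F : TangentBundle (𝓡 n) M → ℝ} {S : Spray n M}
  {β : ∀ x : M, TangentSpace (𝓡 n) x →L[ℝ] ℝ}

lemma IsFinsler.localExpr_pos (hF : IsFinsler F) {p : M} {z : Vec n × Vec n}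
    (hz : z ∈ slitDomain n p) : 0 < localExpr F p z :=
  hF.pos _ (tangentChart_symm_mem_slit hz)

lemma IsFinsler.contDiffAt_localExpr (hF : IsFinsler F) {p : M} {z : Vec n × Vec n}
    (hz : z ∈ slitDomain n p) : ContDiffAt ℝ ∞ (localExpr F p) z :=
  (contDiffOn_localExpr hF.smooth p).contDiffAt ((isOpen_slitDomain p).mem_nhds hz)

lemma exists_linear_localExpr (β : ∀ x : M, TangentSpace (𝓡 n) x →L[ℝ] ℝ) (p : M) :
    ∀ x ∈ (extChartAt (𝓡 n) p).target,
      ∃ b : Vec n →L[ℝ] ℝ, ∀ y, localExpr (formFun β) p (x, y) = b y := fun _ hx =>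
  let ⟨b, hb, _⟩ := exists_localExpr_formFun_eq β p hx
  ⟨b, hb⟩

lemma contDiffAt_localExpr_formFun (hβ : IsSmoothForm β) {p : M} {z : Vec n × Vec n}
    (hz : z ∈ slitDomain n p) : ContDiffAt ℝ ∞ (localExpr (formFun β) p) z :=
  (contDiffOn_localExpr_formFun hβ p).contDiffAt
    (((isOpen_extChartAt_target p).prod isOpen_univ).mem_nhds ⟨hz.1, trivial⟩)

lemma Spray.contDiffOn_coeff (S : Spray n M) (p : M) :
    ContDiffOn ℝ ∞ (S.coeff p) (slitDomain n p) :=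
  (S.smooth p).snd.const_smul _

lemma Spray.coeff_homogeneous (S : Spray n M) (p : M) (z : Vec n × Vec n)
    (hz : z ∈ slitDomain n p) (c : ℝ) (hc : 0 < c) :
    S.coeff p (z.1, c • z.2) = c ^ 2 • S.coeff p z := by
  rw [Spray.coeff, Spray.coeff, S.homogeneous p z.1 hz.1 z.2 c hc, smul_comm]

/-- The metric tensor of a Finsler function is positive definite in dimension at least two. -/
lemma IsFinsler.metric_pos (hn : 2 ≤ n) (hF : IsFinsler F) {p : M} {z : Vec n × Vec n}
    (hz : z ∈ slitDomain n p) {u : Vec n} (hu : u ≠ 0) :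
    0 < dY u (dY u (localExpr (energy F) p)) z := by
  obtain ⟨x, y⟩ := z
  have hE : ∀ y, y ≠ 0 → ContDiffAt ℝ ∞ (localExpr (energy F) p) (x, y) := fun y hy =>
    ((hF.contDiffAt_localExpr (z := (x, y)) ⟨hz.1, hy⟩).pow 2).div_const 2
  have hslice : ∀ y, y ≠ 0 → ContDiffAt ℝ ∞ (fun y => localExpr (energy F) p (x, y)) y :=
    fun y hy => ContDiffAt.comp (f := fun y : Vec n => (x, y)) y (hE y hy) (by fun_prop)
  rw [← fderiv_fderiv_slice (hE y hz.2)]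
  refine hessian_pos_of_nondegenerate (by rw [finrank_euclideanSpace_fin]; omega)
    (fun y hy => (hslice y hy).contDiffWithinAt) (fun y hy => ?_) (fun y hy c hc => ?_)
    (fun y hy u h => ?_) hz.2 hu
  · exact div_pos (pow_pos (hF.localExpr_pos (z := (x, y)) ⟨hz.1, hy⟩) 2) two_pos
  · have := localExpr_homogeneous hF.homogeneous p (z := (x, y)) ⟨hz.1, hy⟩ hc
    change localExpr F p (x, c • y) ^ 2 / 2 = c ^ 2 * (localExpr F p (x, y) ^ 2 / 2)
    rw [this]; ring
  · exact hF.nondegenerate p (x, y) ⟨hz.1, hy⟩ u fun w => by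
      rw [← fderiv_fderiv_slice (hE y hy), h w]

/-- A parallel `1`-form vanishing at a point vanishes on the whole connected component. -/
lemma form_ne_zero_of_parallel (hn : 2 ≤ n) (hβ : IsSmoothForm β) (hpar : S.IsParallel β)
    (hne : ∀ x : M, ∃ x' ∈ connectedComponent x, β x' ≠ 0) (x : M) : β x ≠ 0 := by
  have : Nontrivial (Vec n) :=
    Module.nontrivial_of_finrank_pos (R := ℝ) (by rw [finrank_euclideanSpace_fin]; omega)
  obtain ⟨y₀, hy₀⟩ := exists_ne (0 : Vec n)
  -- the vanishing of the form read in the chart at `p`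
  have hchart : ∀ p q : M, q ∈ (extChartAt (𝓡 n) p).source →
      (β q = 0 ↔ ∀ u, localExpr (formFun β) p (extChartAt (𝓡 n) p q, u) = 0) := fun p q hq => by
    obtain ⟨b, hb, hb0⟩ := exists_localExpr_formFun_eq β p ((extChartAt (𝓡 n) p).map_source hq)
    rw [(extChartAt (𝓡 n) p).left_inv hq] at hb0
    rw [← hb0, ContinuousLinearMap.ext_iff]
    simp only [hb]; rfl
  have hZopen : IsOpen {q : M | β q = 0} := by
    rw [isOpen_iff_mem_nhds]
    intro p hp
    have h := eventually_eq_zero_of_parallel (isOpen_extChartAt_target p)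
      (contDiffOn_localExpr_formFun hβ p) (exists_linear_localExpr β p) (S.contDiffOn_coeff p)
      (hpar p) (mem_extChartAt_target p) hy₀ ((hchart p p (mem_extChartAt_source p)).1 hp)
    filter_upwards [(continuousAt_extChartAt (I := 𝓡 n) p).eventually h,
      extChartAt_source_mem_nhds (I := 𝓡 n) p] with q h1 h2
    exact (hchart p q h2).2 h1
  have hZclosed : IsClosed {q : M | β q = 0} := by
    rw [← isOpen_compl_iff, isOpen_iff_mem_nhds]
    intro p hp
    obtain ⟨u, hu⟩ : ∃ u, localExpr (formFun β) p (extChartAt (𝓡 n) p p, u) ≠ 0 := by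
      by_contra! h; exact hp ((hchart p p (mem_extChartAt_source p)).2 h)
    have hc : ContinuousAt (localExpr (formFun β) p) (extChartAt (𝓡 n) p p, u) :=
      ((contDiffOn_localExpr_formFun hβ p).contDiffAt
        (((isOpen_extChartAt_target p).prod isOpen_univ).mem_nhds
          ⟨mem_extChartAt_target p, trivial⟩)).continuousAt
    have hc' : ContinuousAt (fun q => localExpr (formFun β) p (extChartAt (𝓡 n) p q, u)) p :=
      ContinuousAt.comp (f := fun q => (extChartAt (𝓡 n) p q, u)) hc
        ((continuousAt_extChartAt p).prodMk continuousAt_const)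
    filter_upwards [hc'.eventually_ne hu, extChartAt_source_mem_nhds (I := 𝓡 n) p] with q h1 h2 h3
    exact h1 ((hchart p q h2).1 h3 u)
  intro hx
  obtain ⟨x', hx', hx'0⟩ := hne x
  exact hx'0 (isPreconnected_connectedComponent.subset_isClopen ⟨hZclosed, hZopen⟩
    ⟨x, mem_connectedComponent, hx⟩ hx')

/-- A criterion for functional independence of `F` and `F'`, where `F'` is a function of `F` and of
a nowhere zero `1`-form: at points where `β` is nonzero, `∂̇_i F'` is congruent to `c ∂̇_i F` modulo
`b_i`, but the two differ in the direction of `y`. -/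
lemma functionallyIndependent_pair (hn : 2 ≤ n) (hF : IsFinsler F) (hβ0 : ∀ x, β x ≠ 0)
    {F' : TangentBundle (𝓡 n) M → ℝ}
    (hF' : ContMDiffOn (𝓡 n).tangent 𝓘(ℝ, ℝ) ∞ F' (slit n M))
    (h : ∀ p : M, ∀ z ∈ slitDomain n p, localExpr (formFun β) p z ≠ 0 → ∃ c : ℝ,
      (∀ u, localExpr (formFun β) p (z.1, u) = 0 →
        dY u (localExpr F' p) z = c * dY u (localExpr F p) z) ∧
      dY z.2 (localExpr F' p) z ≠ c * dY z.2 (localExpr F p) z) :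
    FunctionallyIndependent ![F, F'] := by
  intro U hU hUs ⟨v, hv⟩
  set p := v.1 with hp
  have hvsrc : v ∈ (tangentChart (n := n) p).source := by
    rw [tangentChart, extChartAt_source]
    exact (TangentBundle.mem_chart_source_iff _ _).2 (mem_chart_source _ _)
  set z₀ := tangentChart p v with hz₀
  have hz₀t : z₀ ∈ (tangentChart (n := n) p).target := (tangentChart p).map_source hvsrc
  have hx : z₀.1 ∈ (extChartAt (𝓡 n) p).target := by
    rw [tangentChart_target] at hz₀t; exact hz₀t.1
  obtain ⟨A, hA⟩ := exists_tangentChart_symm_eq p hx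
  have hz₀symm : (tangentChart p).symm z₀ = v := (tangentChart p).left_inv hvsrc
  have hz₀slit : z₀ ∈ slitDomain n p := by
    refine ⟨hx, fun h0 => hUs hv ?_⟩
    have h1 := hA z₀.2
    rw [show (z₀.1, z₀.2) = z₀ from rfl, hz₀symm, show z₀.2 = 0 from h0, map_zero] at h1
    rw [h1]
  obtain ⟨b, hb, hb0⟩ := exists_localExpr_formFun_eq β p hx
  obtain ⟨u, hu, hbu⟩ : ∃ u : Vec n, u ≠ 0 ∧ b u = 0 := by
    have hlt : Module.finrank ℝ ℝ < Module.finrank ℝ (Vec n) := by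
      rw [finrank_euclideanSpace_fin, Module.finrank_self]; omega
    have hker : LinearMap.ker b.toLinearMap ≠ ⊥ := LinearMap.ker_ne_bot_of_finrank_lt hlt
    obtain ⟨u, hu, hu0⟩ := (Submodule.ne_bot_iff _).1 hker
    exact ⟨u, hu0, hu⟩
  have hcont : ContinuousOn (tangentChart (n := n) p).symm (slitDomain n p) :=
    (contMDiffOn_tangentChart_symm p).continuousOn.mono fun _ hz => mem_tangentChart_target hz
  obtain ⟨y, hyN, hby, hdy⟩ := exists_dY_ne_zero (isOpen_slitDomain p)
    (contDiffOn_localExpr hF.smooth p) hu (hF.nondegenerate p) (fun h => hβ0 _ (hb0.1 h))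
    (inter_subset_left (t := (tangentChart (n := n) p).symm ⁻¹' U))
    (hcont.isOpen_inter_preimage (isOpen_slitDomain p) hU)
    (x := z₀.1) (y := z₀.2) ⟨hz₀slit, by rw [mem_preimage]; exact hz₀symm ▸ hv⟩
  refine ⟨_, hyN.2, ?_⟩
  obtain ⟨c, hc1, hc2⟩ := h p _ hyN.1 (by rwa [hb])
  have hfun : (fun i => differential (![F, F'] i) ((tangentChart p).symm (z₀.1, y))) =
      ![differential F ((tangentChart p).symm (z₀.1, y)),
        differential F' ((tangentChart p).symm (z₀.1, y))] := by
    ext i : 1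
    fin_cases i <;> rfl
  rw [hfun, LinearIndependent.pair_iff]
  intro s t hst
  have key : ∀ w, s * dY w (localExpr F p) (z₀.1, y) + t * dY w (localExpr F' p) (z₀.1, y) = 0 :=
    fun w => by
      have := DFunLike.congr_fun hst (mfderiv 𝓘(ℝ, Vec n × Vec n) (𝓡 n).tangent
        (tangentChart (n := n) p).symm (z₀.1, y) (0, w))
      rw [dY, dY, fderiv_localExpr hF.smooth hyN.1, fderiv_localExpr hF' hyN.1]
      exact this
  -- evaluate the relation on `u^i ∂̇_i`, then on `y^i ∂̇_i`
  have hs : s + t * c = 0 := by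
    have h1 := key u
    rw [hc1 u (by rw [hb, hbu])] at h1
    have h2 : (s + t * c) * dY u (localExpr F p) (z₀.1, y) = 0 := by linarith
    exact (mul_eq_zero.1 h2).resolve_right hdy
  have ht : t = 0 := by
    have h1 := key y
    have h2 : t * (dY y (localExpr F' p) (z₀.1, y) - c * dY y (localExpr F p) (z₀.1, y)) = 0 := by
      linear_combination h1 - hs * dY y (localExpr F p) (z₀.1, y)
    exact (mul_eq_zero.1 h2).resolve_right (sub_ne_zero.2 hc2)
  exact ⟨by simpa [ht] using hs, ht⟩

lemma eulerLagrange_localExpr (hF : IsFinsler F) (hS : S.IsGeodesicSpray F) {p : M}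
    {z : Vec n × Vec n} (hz : z ∈ slitDomain n p) :
    fderiv ℝ (localExpr F p) z (z.2, -(2 : ℝ) • S.coeff p z) = 0 ∧
      ∀ w, fderiv ℝ (dY w (localExpr F p)) z (z.2, -(2 : ℝ) • S.coeff p z) =
        dX w (localExpr F p) z :=
  eulerLagrange_of_half_sq (isOpen_slitDomain p) (contDiffOn_localExpr hF.smooth p)
    (fun _ hz _ hc => localExpr_homogeneous hF.homogeneous p hz hc) hz (hF.localExpr_pos hz) _
    (hS p z hz)

lemma eulerLagrange_localExpr_formFun (hβ : IsSmoothForm β) (hpar : S.IsParallel β) {p : M}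
    {z : Vec n × Vec n} (hz : z ∈ slitDomain n p) :
    fderiv ℝ (localExpr (formFun β) p) z (z.2, -(2 : ℝ) • S.coeff p z) = 0 ∧
      ∀ w, fderiv ℝ (dY w (localExpr (formFun β) p)) z (z.2, -(2 : ℝ) • S.coeff p z) =
        dX w (localExpr (formFun β) p) z :=
  eulerLagrange_of_parallel (isOpen_extChartAt_target p) (contDiffOn_localExpr_formFun hβ p)
    (exists_linear_localExpr β p) (S.contDiffOn_coeff p) (S.coeff_homogeneous p) (hpar p) hz

lemma dY_localExpr_formFun (hβ : IsSmoothForm β) {p : M} {z : Vec n × Vec n}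
    (hz : z ∈ slitDomain n p) (w : Vec n) :
    dY w (localExpr (formFun β) p) z = localExpr (formFun β) p (z.1, w) :=
  dY_of_linear (isOpen_extChartAt_target p) (contDiffOn_localExpr_formFun hβ p)
    (exists_linear_localExpr β p) hz.1 w

lemma dY_dY_localExpr_formFun (hβ : IsSmoothForm β) {p : M} {z : Vec n × Vec n}
    (hz : z ∈ slitDomain n p) (u w : Vec n) :
    dY u (dY w (localExpr (formFun β) p)) z = 0 :=
  dY_dY_of_linear (isOpen_extChartAt_target p) (contDiffOn_localExpr_formFun hβ p)
    (exists_linear_localExpr β p) hz.1 u w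

/-! ### The Randers change -/

lemma isFinsler_add_form (hF : IsFinsler F) (hβ : IsSmoothForm β)
    (hpos : ∀ v ∈ slit n M, 0 < F v + formFun β v) :
    IsFinsler (fun v => F v + formFun β v) where
  smooth := hF.smooth.add hβ.contMDiffOn
  pos := hpos
  homogeneous x y c hc := by
    rw [hF.homogeneous x y c hc, formFun_homogeneous β]; ring
  nondegenerate p z hz u hu := by
    refine nondegenerate_of_dY_dY_eq (isOpen_slitDomain p) (contDiffOn_localExpr hF.smooth p)
      (contDiffOn_localExpr (hF.smooth.add hβ.contMDiffOn) p)
      (fun _ hz _ hc => localExpr_homogeneous hF.homogeneous p hz hc)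
      (fun _ hz _ hc => localExpr_homogeneous (fun x y c hc => ?_) p hz hc) hz
      (hF.localExpr_pos hz) (hpos _ (tangentChart_symm_mem_slit hz)) (fun u w => ?_)
      (hF.nondegenerate p z hz) u hu
    · change F _ + formFun β _ = _ * (F _ + formFun β _)
      rw [hF.homogeneous x y c hc, formFun_homogeneous β]; ring
    · refine (fderiv_dY_add (hF.contDiffAt_localExpr hz)
        (contDiffAt_localExpr_formFun hβ hz) w (0, u)).trans ?_
      change _ + dY u (dY w (localExpr (formFun β) p)) z = _
      rw [dY_dY_localExpr_formFun hβ hz, add_zero]; rfl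

lemma isGeodesicSpray_add_form (hF : IsFinsler F) (hS : S.IsGeodesicSpray F)
    (hβ : IsSmoothForm β) (hpar : S.IsParallel β) :
    S.IsGeodesicSpray (fun v => F v + formFun β v) := by
  intro p z hz w
  have hf := hF.contDiffAt_localExpr hz
  have hb := contDiffAt_localExpr_formFun hβ hz
  obtain ⟨f0, f1⟩ := eulerLagrange_localExpr hF hS hz
  obtain ⟨b0, b1⟩ := eulerLagrange_localExpr_formFun hβ hpar hz
  refine half_sq_eulerLagrange (f := fun z => localExpr F p z + localExpr (formFun β) p z)
    (hf.add hb) ?_ (fun w => ?_) w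
  · rw [fderiv_add_eval hf hb, f0, b0, add_zero]
  · rw [fderiv_dY_add hf hb, f1, b1]
    exact (fderiv_add_eval hf hb _).symm

lemma isLandsberg_add_form (hF : IsFinsler F) (hL : S.IsLandsberg F)
    (hβ : IsSmoothForm β) (hpar : S.IsParallel β) :
    S.IsLandsberg (fun v => F v + formFun β v) := by
  intro p z hz u v w
  have hf : dY (S.berwaldCurvature p u v w z) (localExpr F p) z = 0 :=
    (mul_eq_zero.1 (hL p z hz u v w)).resolve_left
      (mul_ne_zero (by norm_num) (hF.localExpr_pos hz).ne')
  have hb : dY (S.berwaldCurvature p u v w z) (localExpr (formFun β) p) z = 0 :=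
    dY_berwald_of_parallel (isOpen_extChartAt_target p) (contDiffOn_localExpr_formFun hβ p)
      (exists_linear_localExpr β p) (S.contDiffOn_coeff p) (hpar p) hz u v w
  have h : dY (S.berwaldCurvature p u v w z) (localExpr (fun v => F v + formFun β v) p) z = 0 :=
    (fderiv_add_eval (hF.contDiffAt_localExpr hz) (contDiffAt_localExpr_formFun hβ hz) _).trans
      (by rw [dY] at hf hb; rw [hf, hb, add_zero])
  rw [Spray.landsbergCurvature, h, mul_zero]

lemma functionallyIndependent_add_form (hn : 2 ≤ n) (hF : IsFinsler F) (hβ : IsSmoothForm β)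
    (hβ0 : ∀ x, β x ≠ 0) : FunctionallyIndependent ![F, fun v => F v + formFun β v] := by
  refine functionallyIndependent_pair hn hF hβ0 (hF.smooth.add hβ.contMDiffOn)
    fun p z hz hbz => ⟨1, ?_⟩
  have h : ∀ u, dY u (localExpr (fun v => F v + formFun β v) p) z =
      dY u (localExpr F p) z + localExpr (formFun β) p (z.1, u) := fun u => by
    rw [← dY_localExpr_formFun hβ hz]
    exact fderiv_add_eval (hF.contDiffAt_localExpr hz) (contDiffAt_localExpr_formFun hβ hz) _
  refine ⟨fun u hu => by rw [h, hu, add_zero, one_mul], ?_⟩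
  rw [h, one_mul]
  simpa using hbz

/-! ### The function `√(F² + β²)` -/

/-- The function `√(F² + β²)`, positive whatever the size of `β`. -/
noncomputable def sqrtChange (F : TangentBundle (𝓡 n) M → ℝ) (β : ∀ x : M, TangentSpace (𝓡 n) x →L[ℝ] ℝ) :
    TangentBundle (𝓡 n) M → ℝ :=
  fun v => √(F v ^ 2 + formFun β v ^ 2)

lemma localExpr_energy_sqrtChange (F : TangentBundle (𝓡 n) M → ℝ)
    (β : ∀ x : M, TangentSpace (𝓡 n) x →L[ℝ] ℝ) (p : M) :
    localExpr (energy (sqrtChange F β)) p =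
      fun z => localExpr F p z ^ 2 / 2 + localExpr (formFun β) p z ^ 2 / 2 := by
  ext z
  simp only [localExpr, energy, sqrtChange]
  rw [Real.sq_sqrt (by positivity)]; ring

lemma contMDiffOn_sqrtChange (hF : IsFinsler F) (hβ : IsSmoothForm β) :
    ContMDiffOn (𝓡 n).tangent 𝓘(ℝ, ℝ) ∞ (sqrtChange F β) (slit n M) := by
  intro v hv
  have h1 : ContMDiffWithinAt (𝓡 n).tangent 𝓘(ℝ, ℝ) ∞ (fun v => F v ^ 2 + formFun β v ^ 2)
      (slit n M) v := ((hF.smooth.pow 2).add (hβ.contMDiffOn.pow 2)) v hv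
  have hpos : F v ^ 2 + formFun β v ^ 2 ≠ 0 :=
    (add_pos_of_pos_of_nonneg (pow_pos (hF.pos v hv) 2) (sq_nonneg _)).ne'
  exact (Real.contDiffAt_sqrt hpos).contMDiffAt.comp_contMDiffWithinAt v h1

lemma isFinsler_sqrtChange (hn : 2 ≤ n) (hF : IsFinsler F) (hβ : IsSmoothForm β) :
    IsFinsler (sqrtChange F β) where
  smooth := contMDiffOn_sqrtChange hF hβ
  pos v hv := Real.sqrt_pos.2 (add_pos_of_pos_of_nonneg (pow_pos (hF.pos v hv) 2) (sq_nonneg _))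
  homogeneous x y c hc := by
    rw [sqrtChange, sqrtChange, hF.homogeneous x y c hc, formFun_homogeneous β, mul_pow, mul_pow,
      ← mul_add, Real.sqrt_mul (sq_nonneg c), Real.sqrt_sq hc.le]
  nondegenerate p z hz u hu := by
    -- evaluate the metric `g + b ⊗ b` on `(u, u)`
    by_contra hu0
    have hf := hF.contDiffAt_localExpr hz
    have hb := contDiffAt_localExpr_formFun hβ hz
    have h1 := hu u
    rw [localExpr_energy_sqrtChange, dY, fderiv_dY_add ((hf.pow 2).div_const 2)
      ((hb.pow 2).div_const 2), fderiv_dY_half_sq hb] at h1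
    have h2 : fderiv ℝ (dY u (localExpr (formFun β) p)) z (0, u) = 0 :=
      dY_dY_localExpr_formFun hβ hz u u
    have h3 : 0 < fderiv ℝ (dY u fun z => localExpr F p z ^ 2 / 2) z (0, u) :=
      hF.metric_pos hn hz hu0
    rw [h2, mul_zero, zero_add] at h1
    exact (add_pos_of_pos_of_nonneg h3
      (mul_self_nonneg (dY u (localExpr (formFun β) p) z))).ne' h1

lemma isGeodesicSpray_sqrtChange (hF : IsFinsler F) (hS : S.IsGeodesicSpray F)
    (hβ : IsSmoothForm β) (hpar : S.IsParallel β) : S.IsGeodesicSpray (sqrtChange F β) := by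
  intro p z hz w
  have hf := hF.contDiffAt_localExpr hz
  have hb := contDiffAt_localExpr_formFun hβ hz
  obtain ⟨b0, b1⟩ := eulerLagrange_localExpr_formFun hβ hpar hz
  have h1 : fderiv ℝ (dY w fun z => localExpr F p z ^ 2 / 2) z (z.2, -(2 : ℝ) • S.coeff p z) =
      dX w (fun z => localExpr F p z ^ 2 / 2) z := hS p z hz w
  rw [localExpr_energy_sqrtChange, fderiv_dY_add ((hf.pow 2).div_const 2) ((hb.pow 2).div_const 2),
    half_sq_eulerLagrange hb b0 b1, h1, dX, dX, dX,
    fderiv_add_eval ((hf.pow 2).div_const 2) ((hb.pow 2).div_const 2)]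

lemma functionallyIndependent_sqrtChange (hn : 2 ≤ n) (hF : IsFinsler F) (hβ : IsSmoothForm β)
    (hβ0 : ∀ x, β x ≠ 0) : FunctionallyIndependent ![F, sqrtChange F β] := by
  have hF' := isFinsler_sqrtChange hn hF hβ
  refine functionallyIndependent_pair hn hF hβ0 hF'.smooth fun p z hz hbz =>
    ⟨localExpr F p z / localExpr (sqrtChange F β) p z, ?_⟩
  have hpos := hF'.localExpr_pos hz
  -- differentiate the energies: `F' ∂̇F' = F ∂̇F + β b`
  have h : ∀ u, dY u (localExpr (sqrtChange F β) p) z =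
      localExpr F p z / localExpr (sqrtChange F β) p z * dY u (localExpr F p) z +
      localExpr (formFun β) p z / localExpr (sqrtChange F β) p z *
        localExpr (formFun β) p (z.1, u) := fun u => by
    have hf := hF.contDiffAt_localExpr hz
    have hb := contDiffAt_localExpr_formFun hβ hz
    have h1 := dY_half_sq ((hF'.contDiffAt_localExpr hz).differentiableAt (by simp)) u
    have h2 : (fun z => localExpr (sqrtChange F β) p z ^ 2 / 2) = _ :=
      localExpr_energy_sqrtChange F β p
    rw [h2, dY, fderiv_add_eval ((hf.pow 2).div_const 2) ((hb.pow 2).div_const 2), ← dY, ← dY,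
      dY_half_sq (hf.differentiableAt (by simp)), dY_half_sq (hb.differentiableAt (by simp)),
      dY_localExpr_formFun hβ hz] at h1
    field_simp
    linarith
  refine ⟨fun u hu => by rw [h, hu, mul_zero, add_zero], ?_⟩
  rw [h, Ne, add_eq_left]
  exact mul_ne_zero (div_ne_zero hbz hpos.ne') hbz

end Manifold

end Finsler

theorem mainTheorem3 {n : ℕ} (hn : 2 ≤ n) {M : Type*} [TopologicalSpace M]
    [ChartedSpace (EuclideanSpace ℝ (Fin n)) M] [IsManifold (𝓡 n) ∞ M]
    (F : TangentBundle (𝓡 n) M → ℝ) (hF : Finsler.IsFinsler F)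
    (S : Finsler.Spray n M) (hS : S.IsGeodesicSpray F) (hL : S.IsLandsberg F)
    (β : ∀ x : M, TangentSpace (𝓡 n) x →L[ℝ] ℝ) (hβ : Finsler.IsSmoothForm β)
    (hpar : S.IsParallel β) (hne : ∀ x : M, ∃ x' ∈ connectedComponent x, β x' ≠ 0) :
    2 ≤ S.metrizabilityFreedom ∧
      ((∀ v ∈ Finsler.slit n M, 0 < F v + Finsler.formFun β v) →
        Finsler.IsFinsler (fun v => F v + Finsler.formFun β v) ∧
        S.IsGeodesicSpray (fun v => F v + Finsler.formFun β v) ∧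
        S.IsLandsberg (fun v => F v + Finsler.formFun β v) ∧
        Finsler.FunctionallyIndependent ![F, fun v => F v + Finsler.formFun β v]) := by
  have hβ0 := Finsler.form_ne_zero_of_parallel hn hβ hpar hne
  refine ⟨le_sSup ⟨2, ![F, Finsler.sqrtChange F β], rfl, fun i => ?_,
    Finsler.functionallyIndependent_sqrtChange hn hF hβ hβ0⟩, fun hpos =>
    ⟨Finsler.isFinsler_add_form hF hβ hpos, Finsler.isGeodesicSpray_add_form hF hS hβ hpar,
      Finsler.isLandsberg_add_form hF hL hβ hpar,
      Finsler.functionallyIndependent_add_form hn hF hβ hβ0⟩⟩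
  fin_cases i
  · exact ⟨hF, hS⟩
  · exact ⟨Finsler.isFinsler_sqrtChange hn hF hβ, Finsler.isGeodesicSpray_sqrtChange hF hS hβ hpar⟩
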